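/- Let $(M,g)$ be a spacetime, that is, a smooth (Hausdorff, second countable) manifold $M$ of dimension $N+1\ge 1$ with a smooth Lorentzian metric $g$ of signature $(-,+,\dots,+)$ and a time orientation (given by a continuous timelike vector field $T$). A nonzero tangent vector $v$ with $g(v,v)\le 0$ is future-directed causal if $g(T,v)<0$ and past-directed causal if $g(T,v)>0$. A future-directed (past-directed) causal curve is a curve $\gamma\colon[a,b]\to M$ that is locally Lipschitz with respect to any Riemannian metric on $M$ and whose velocity $\dot\gamma$ is future-directed (past-directed) causal almost everywhere. The causal relation is $$J^+=\{(p,q)\in M\times M : p=q \text{ or there is a future-directed causal curve from } p \text{ to } q\}.$$ Let $\tau\colon M\to\mathbb R$ be a temporal function, that is, a smooth function whose gradient $\nabla\tau$ (defined by $g(\nabla\tau,\cdot)=d\tau$) is everywhere timelike and past-directed. A piecewise causal path is a curve $\beta\colon[a,b]\to M$ with a partition $a=s_0<s_1<\dots<s_k=b$ such that every restriction $\beta|_{[s_{i-1},s_i]}$ is a future-directed or a past-directed causal curve; its null length is $\hat L_\tau(\beta)=\sum_{i=1}^{k}|\tau(\beta(s_i))-\tau(\beta(s_{i-1}))|$.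 The null distance $\hat d_\tau(p,q)$ is the infimum of $\hat L_\tau(\beta)$ over all piecewise causal paths $\beta$ from $p$ to $q$ ($+\infty$ if there are none), and the null distance relation is $$\hat R^+_\tau=\{(p,q)\in M\times M : \hat d_\tau(p,q)=\tau(q)-\tau(p)\}.$$ Then every point $x\in M$ has a neighborhood $U$ such that $$J^+\cap(U\times U)=\hat R^+_\tau\cap(U\times U).$$ -/

import Mathlib

open Set MeasureTheory
open scoped Manifold ContDiff Topology Bundle NNReal

noncomputable section

namespace Spacetime

variable {N : ℕ} {M : Type*} [TopologicalSpace M]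
  [ChartedSpace (EuclideanSpace ℝ (Fin (N + 1))) M]

/-- A smooth Lorentzian metric of signature `(-,+,…,+)` on the `(N+1)`-dimensional manifold `M`.
The field `lorentzian` says that every tangent space splits orthogonally into a negative definite
line and a positive definite complement. -/
structure LorentzMetric (N : ℕ) (M : Type*) [TopologicalSpace M]
    [ChartedSpace (EuclideanSpace ℝ (Fin (N + 1))) M] [IsManifold (𝓡 (N + 1)) ∞ M] where
  /-- the bilinear form on each tangent space -/
  form : ∀ x : M, TangentSpace (𝓡 (N + 1)) x →L[ℝ] TangentSpace (𝓡 (N + 1)) x →L[ℝ] ℝ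
  symm : ∀ (x : M) (v w : TangentSpace (𝓡 (N + 1)) x), form x v w = form x w v
  lorentzian : ∀ x : M, ∃ v : TangentSpace (𝓡 (N + 1)) x, form x v v < 0 ∧
    ∀ w : TangentSpace (𝓡 (N + 1)) x, form x v w = 0 → w ≠ 0 → 0 < form x w w
  contMDiff : ContMDiff (𝓡 (N + 1))
    ((𝓡 (N + 1)).prod 𝓘(ℝ, EuclideanSpace ℝ (Fin (N + 1)) →L[ℝ]
      EuclideanSpace ℝ (Fin (N + 1)) →L[ℝ] ℝ)) ∞
    (fun x : M ↦ Bundle.TotalSpace.mk'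
      (EuclideanSpace ℝ (Fin (N + 1)) →L[ℝ] EuclideanSpace ℝ (Fin (N + 1)) →L[ℝ] ℝ)
      (E := fun x : M ↦
        TangentSpace (𝓡 (N + 1)) x →L[ℝ] TangentSpace (𝓡 (N + 1)) x →L[ℝ] ℝ) x (form x))

variable [IsManifold (𝓡 (N + 1)) ∞ M]

/-- A time orientation of `(M, g)`, given by a continuous timelike vector field. -/
structure TimeOrientation (g : LorentzMetric N M) where
  /-- the vector field, declared to be future-directed -/
  field : ∀ x : M, TangentSpace (𝓡 (N + 1)) x
  continuous : Continuous
    (fun x : M ↦ (⟨x, field x⟩ : TangentBundle (𝓡 (N + 1)) M))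
  timelike : ∀ x : M, g.form x (field x) (field x) < 0

variable {g : LorentzMetric N M}

/-- A nonzero vector `v` with `g(v,v) ≤ 0` in the same cone as the time-orienting field. -/
def IsFutureCausal (T : TimeOrientation g) (x : M) (v : TangentSpace (𝓡 (N + 1)) x) : Prop :=
  v ≠ 0 ∧ g.form x v v ≤ 0 ∧ g.form x (T.field x) v < 0

/-- A nonzero vector `v` with `g(v,v) ≤ 0` in the cone opposite to the time-orienting field. -/
def IsPastCausal (T : TimeOrientation g) (x : M) (v : TangentSpace (𝓡 (N + 1)) x) : Prop :=
  v ≠ 0 ∧ g.form x v v ≤ 0 ∧ 0 < g.form x (T.field x) v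

/-- `γ` is continuous on `s` and locally Lipschitz on `s` in local coordinates. As smooth coordinate
changes are locally Lipschitz, and every Riemannian distance is locally bi-Lipschitz to the
Euclidean distance of a chart, this is the same as being locally Lipschitz for the distance of any
Riemannian metric. -/
def IsLocLipschitzOn (N : ℕ) {M : Type*} [TopologicalSpace M]
    [ChartedSpace (EuclideanSpace ℝ (Fin (N + 1))) M] (γ : ℝ → M) (s : Set ℝ) : Prop :=
  ContinuousOn γ s ∧ ∀ t ∈ s, ∃ K : ℝ≥0, ∃ u ∈ 𝓝[s] t,
    LipschitzOnWith K (fun r ↦ extChartAt (𝓡 (N + 1)) (γ t) (γ r)) u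

/-- The velocity `γ'(t)`. -/
def velocity (N : ℕ) {M : Type*} [TopologicalSpace M]
    [ChartedSpace (EuclideanSpace ℝ (Fin (N + 1))) M] (γ : ℝ → M) (t : ℝ) :
    TangentSpace (𝓡 (N + 1)) (γ t) :=
  mfderiv 𝓘(ℝ, ℝ) (𝓡 (N + 1)) γ t (1 : ℝ)

/-- `γ` restricted to `[a,b]` is a future-directed causal curve: locally Lipschitz, with velocity
existing and future-directed causal almost everywhere. Only the values of `γ` on `[a,b]` matter. -/
def IsFutureCausalCurve (T : TimeOrientation g) (γ : ℝ → M) (a b : ℝ) : Prop :=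
  IsLocLipschitzOn N γ (Icc a b) ∧
    ∀ᵐ t ∂(volume.restrict (Icc a b)),
      MDifferentiableAt 𝓘(ℝ, ℝ) (𝓡 (N + 1)) γ t ∧ IsFutureCausal T (γ t) (velocity N γ t)

/-- `γ` restricted to `[a,b]` is a past-directed causal curve. -/
def IsPastCausalCurve (T : TimeOrientation g) (γ : ℝ → M) (a b : ℝ) : Prop :=
  IsLocLipschitzOn N γ (Icc a b) ∧
    ∀ᵐ t ∂(volume.restrict (Icc a b)),
      MDifferentiableAt 𝓘(ℝ, ℝ) (𝓡 (N + 1)) γ t ∧ IsPastCausal T (γ t) (velocity N γ t)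

/-- The causal relation `J⁺`; it is reflexive by convention. -/
def causalRel (T : TimeOrientation g) : Set (M × M) :=
  {x | x.1 = x.2 ∨ ∃ (γ : ℝ → M) (a b : ℝ), a < b ∧
    IsFutureCausalCurve T γ a b ∧ γ a = x.1 ∧ γ b = x.2}

/-- A piecewise causal path from `p` to `q`: a partition `s 0 < s 1 < … < s k` and a curve which on
every `[s i, s (i+1)]` is future-directed causal or past-directed causal. For `k = 0` it is a
one-point path. -/
structure PiecewiseCausalPath (T : TimeOrientation g) (p q : M) where
  /-- the number of pieces -/
  k : ℕ
  /-- the partition -/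
  s : Fin (k + 1) → ℝ
  strictMono : StrictMono s
  /-- the curve; only its values on `[s 0, s k]` matter -/
  toFun : ℝ → M
  causal : ∀ i : Fin k, IsFutureCausalCurve T toFun (s i.castSucc) (s i.succ) ∨
    IsPastCausalCurve T toFun (s i.castSucc) (s i.succ)
  source : toFun (s 0) = p
  target : toFun (s (Fin.last k)) = q

/-- The null length `∑ᵢ |τ(β(sᵢ₊₁)) - τ(β(sᵢ))|`. -/
def PiecewiseCausalPath.nullLength {T : TimeOrientation g} {p q : M}
    (β : PiecewiseCausalPath T p q) (τ : M → ℝ) : ℝ :=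
  ∑ i : Fin β.k, |τ (β.toFun (β.s i.succ)) - τ (β.toFun (β.s i.castSucc))|

/-- The null distance, with value `+∞` if no piecewise causal path joins `p` to `q` (which happens
only when `p` and `q` lie in different connected components). -/
def nullDist (T : TimeOrientation g) (τ : M → ℝ) (p q : M) : EReal :=
  ⨅ β : PiecewiseCausalPath T p q, ((β.nullLength τ : ℝ) : EReal)

/-- The null distance relation `R̂⁺_τ`. -/
def nullDistRel (T : TimeOrientation g) (τ : M → ℝ) : Set (M × M) :=
  {x | nullDist T τ x.1 x.2 = ((τ x.2 - τ x.1 : ℝ) : EReal)}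

/-- `v` is the gradient of `τ` at `x`, i.e. `g(v, w) = dτ(w)` for all `w`; by nondegeneracy of `g`
there is exactly one such `v`. -/
def IsGradientAt (g : LorentzMetric N M) (τ : M → ℝ) (x : M)
    (v : TangentSpace (𝓡 (N + 1)) x) : Prop :=
  ∀ w : TangentSpace (𝓡 (N + 1)) x, g.form x v w = mfderiv (𝓡 (N + 1)) 𝓘(ℝ, ℝ) τ x w

/-- A temporal function: smooth, with past-directed timelike gradient. -/
def IsTemporal (T : TimeOrientation g) (τ : M → ℝ) : Prop :=
  ContMDiff (𝓡 (N + 1)) 𝓘(ℝ, ℝ) ∞ τ ∧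
    ∀ x : M, ∃ v : TangentSpace (𝓡 (N + 1)) x, IsGradientAt g τ x v ∧
      g.form x v v < 0 ∧ 0 < g.form x (T.field x) v

end Spacetime

end

/-! The null length of a piecewise causal path is the integral of |(τ∘β)'|, the total variation of τ
along it. It is at least τ q - τ p, with equality for future causal curves, so J⁺ is contained in
the null distance relation even globally (`causalRel_subset_nullDistRel`).

Conversely, if the null distance is τ q - τ p, some paths from p to q have variation at most τ q - τ
p + ε; their past-directed parts become negligible as ε → 0, so a limit should be future causal.
Near x, the coordinate speed of a causal curve is at most C|(τ∘γ)'| (`exists_norm_coord_le`), so for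
p, q close to x these paths stay in a coordinate ball (`IsCausalCurve.mem_chartBall`). Sampling them
at first hitting times of the levels of τ gives possibly discontinuous maps z with τ (z t) = t,
C-Lipschitz up to an error C * ε (`IsCausalCurve.exists_sampling`). A pointwise ultrafilter limit is
a genuine Lipschitz curve parametrized by τ (`exists_isFutureCausalCurve`).

Its causality follows by duality. A covector strictly negative on the future cone at a point is
nonpositive on nearby future cones (`eventually_nonpos_of_causal`), so along the paths it increases
by O(ε) (`IsCausalCurve.dual_sub_le_of_nonpos`), and along the limit not at all. Wherever the limit
is differentiable, its velocity satisfies all these inequalities and dτ = 1, which makes it future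
causal (`isFutureCausal_of_forall_dual`). -/

open Filter

namespace Spacetime

section

variable {N : ℕ} {M : Type*} [TopologicalSpace M]
  [ChartedSpace (EuclideanSpace ℝ (Fin (N + 1))) M] [IsManifold (𝓡 (N + 1)) ∞ M]
  {g : LorentzMetric N M} {T : TimeOrientation g} {τ : M → ℝ}

/-! ### Pointwise Lorentzian algebra -/

section Pointwise

variable {z : M} {m n v w : TangentSpace (𝓡 (N + 1)) z}

/-- The orthogonal complement of a timelike vector is positive definite. -/
lemma form_pos_of_orthogonal (hn : g.form z n n < 0) (hw : g.form z n w = 0) (hw0 : w ≠ 0) :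
    0 < g.form z w w := by
  by_contra! hle
  obtain ⟨v₀, hv₀, hpos⟩ := g.lorentzian z
  have hn0 : n ≠ 0 := by rintro rfl; simp at hn
  have key : ∀ a b : ℝ, g.form z (a • n + b • w) (a • n + b • w)
      = a ^ 2 * g.form z n n + b ^ 2 * g.form z w w := by
    intro a b
    have : g.form z w n = 0 := by rw [g.symm]; exact hw
    simp only [map_add, map_smul, add_apply, smul_apply,
      smul_eq_mul, hw, this]
    ring
  -- The form is nonpositive on the span of `n` and `w`; this combination lies in that span and is
  -- orthogonal to `v₀`. If it vanishes, `n` itself is orthogonal to `v₀`.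
  have h1 := hpos (g.form z v₀ w • n + (-g.form z v₀ n) • w)
    (by simp only [map_add, map_smul, smul_eq_mul]; ring)
  rw [key] at h1
  by_cases h0 : g.form z v₀ w • n + (-g.form z v₀ n) • w = 0
  · have h2 := key (g.form z v₀ w) (-g.form z v₀ n)
    have h3 : g.form z v₀ w * g.form z n n = 0 := by
      have := congrArg (g.form z n) h0
      simpa only [map_add, map_smul, smul_eq_mul, hw, mul_zero, add_zero, map_zero] using this
    have h4 : g.form z v₀ w = 0 := (mul_eq_zero.mp h3).resolve_right hn.ne
    rw [h4, zero_smul, zero_add, smul_eq_zero, neg_eq_zero] at h0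
    exact absurd (hpos n (h0.resolve_right hw0) hn0) hn.not_gt
  · have := h1 h0
    nlinarith [mul_nonneg (sq_nonneg (g.form z v₀ w)) (neg_nonneg.mpr hn.le),
      mul_nonneg (sq_nonneg (-g.form z v₀ n)) (neg_nonneg.mpr hle)]

lemma form_nonneg_of_orthogonal (hn : g.form z n n < 0) (hw : g.form z n w = 0) :
    0 ≤ g.form z w w := by
  rcases eq_or_ne w 0 with rfl | h
  · simp
  · exact (form_pos_of_orthogonal hn hw h).le

/-- A nonzero causal vector is not orthogonal to any timelike vector. -/
lemma form_ne_zero_of_causal (hn : g.form z n n < 0) (hv0 : v ≠ 0) (hv : g.form z v v ≤ 0) :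
    g.form z n v ≠ 0 := fun h ↦ hv.not_gt (form_pos_of_orthogonal hn h hv0)

/-- Sign rule for two timelike vectors and a causal one. -/
lemma form_mul_form_mul_form_neg (hn : g.form z n n < 0) (hm : g.form z m m < 0) (hv0 : v ≠ 0)
    (hv : g.form z v v ≤ 0) : g.form z n v * g.form z n m * g.form z m v < 0 := by
  have hnv := form_ne_zero_of_causal hn hv0 hv
  -- Expanding the square of this vector orthogonal to `n` leaves the wanted product as the only
  -- term that can compensate the negative one.
  have h := form_nonneg_of_orthogonal (w := g.form z n v • m + (-g.form z n m) • v) hn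
    (by simp only [map_add, map_smul, smul_eq_mul]; ring)
  simp only [map_add, map_smul, add_apply, smul_apply,
      smul_eq_mul, g.symm z v m] at h
  nlinarith [mul_pos_of_neg_of_neg hm (neg_neg_of_pos (pow_pos (abs_pos.mpr hnv) 2)),
    sq_abs (g.form z n v), mul_nonneg (sq_nonneg (g.form z n m)) (neg_nonneg.mpr hv)]

/-- A vector on which all timelike vectors of the cone of `-n` are nonpositive is causal, if it
lies on the side of this cone. -/
lemma causal_of_forall_timelike (hn : g.form z n n < 0) (hw : 0 < g.form z n w)
    (h : ∀ m, g.form z m m < 0 → 0 < g.form z n m → g.form z m w ≤ 0) : g.form z w w ≤ 0 := by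
  by_contra! hpos
  -- With this `c`, the test vector m = w - c n satisfies g(m,m) = c² g(n,n) < 0 and g(m,w) =
  -- g(w,w)/2 > 0.
  set c : ℝ := g.form z w w / (2 * g.form z n w) with hc
  have hc0 : 0 < c := by positivity
  have hca : c * g.form z n w = g.form z w w / 2 := by rw [hc]; field_simp
  have hm := h (w - c • n)
  simp only [map_sub, map_smul, sub_apply, smul_apply, smul_eq_mul, g.symm z w n] at hm
  nlinarith [hm (by nlinarith [mul_pos hc0 hc0]) (by nlinarith)]

/-- The differential of a function on `M`, as a linear form. -/
noncomputable def differential (τ : M → ℝ) (z : M) : TangentSpace (𝓡 (N + 1)) z →L[ℝ] ℝ :=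
  mfderiv (𝓡 (N + 1)) 𝓘(ℝ, ℝ) τ z

/-- The sign rule for ∇τ, T and v, with g(T,∇τ) > 0, shows that dτ(v) and g(T,v) have opposite
signs. Hence τ can replace T as the time orientation. -/
lemma isFutureCausal_iff (hτ : IsTemporal T τ) :
    IsFutureCausal T z v ↔
      v ≠ 0 ∧ g.form z v v ≤ 0 ∧ 0 < differential τ z v := by
  obtain ⟨n, hn, hnn, hTn⟩ := hτ.2 z
  refine and_congr_right fun hv0 ↦ and_congr_right fun hv ↦ ?_
  rw [show differential τ z v = g.form z n v from (hn v).symm]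
  have h := form_mul_form_mul_form_neg hnn (T.timelike z) hv0 hv
  rw [g.symm z n (T.field z)] at h
  constructor <;> intro h' <;> by_contra! hc
  · nlinarith [mul_pos hTn (neg_pos.mpr h'), mul_nonneg (mul_pos hTn (neg_pos.mpr h')).le (neg_nonneg.mpr hc)]
  · nlinarith [mul_pos hTn h', mul_nonneg (mul_pos hTn h').le hc]

lemma isPastCausal_iff_neg : IsPastCausal T z v ↔ IsFutureCausal T z (-v) := by
  simp [IsPastCausal, IsFutureCausal]

end Pointwise

end

section

variable {N : ℕ} {M : Type*} [TopologicalSpace M]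
  [ChartedSpace (EuclideanSpace ℝ (Fin (N + 1))) M] [IsManifold (𝓡 (N + 1)) ∞ M]
  {g : LorentzMetric N M} {T : TimeOrientation g} {τ : M → ℝ}

/-! ### Tangent vectors in the coordinates of a chart -/

section Coordinates

/-- The coordinates of tangent vectors at `z` with respect to the preferred chart at `x`. -/
noncomputable def coord (x z : M) :
    TangentSpace (𝓡 (N + 1)) z →L[ℝ] EuclideanSpace ℝ (Fin (N + 1)) :=
  (trivializationAt (EuclideanSpace ℝ (Fin (N + 1))) (TangentSpace (𝓡 (N + 1))) x).continuousLinearMapAt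
    ℝ z

/-- The tangent vector at `z` with given coordinates with respect to the preferred chart at `x`. -/
noncomputable def ofCoord (x z : M) :
    EuclideanSpace ℝ (Fin (N + 1)) →L[ℝ] TangentSpace (𝓡 (N + 1)) z :=
  (trivializationAt (EuclideanSpace ℝ (Fin (N + 1))) (TangentSpace (𝓡 (N + 1))) x).symmL ℝ z

variable {x z : M}

lemma ofCoord_coord (hz : z ∈ (chartAt (EuclideanSpace ℝ (Fin (N + 1))) x).source)
    (v : TangentSpace (𝓡 (N + 1)) z) : ofCoord x z (coord x z v) = v :=
  Bundle.Trivialization.symmL_continuousLinearMapAt _ (by simpa using hz) v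

lemma coord_ofCoord (hz : z ∈ (chartAt (EuclideanSpace ℝ (Fin (N + 1))) x).source)
    (u : EuclideanSpace ℝ (Fin (N + 1))) : coord x z (ofCoord x z u) = u :=
  Bundle.Trivialization.continuousLinearMapAt_symmL _ (by simpa using hz) u

lemma coord_eq_mfderiv (hz : z ∈ (chartAt (EuclideanSpace ℝ (Fin (N + 1))) x).source) :
    coord x z = mfderiv (𝓡 (N + 1)) 𝓘(ℝ, EuclideanSpace ℝ (Fin (N + 1)))
      (extChartAt (𝓡 (N + 1)) x) z :=
  TangentBundle.continuousLinearMapAt_trivializationAt hz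

/-- Continuity is joint in base point and coordinates, as needed for compactness over the unit
sphere. -/
lemma continuousAt_ofCoord (hz : z ∈ (chartAt (EuclideanSpace ℝ (Fin (N + 1))) x).source)
    (u : EuclideanSpace ℝ (Fin (N + 1))) :
    ContinuousAt (fun p : M × EuclideanSpace ℝ (Fin (N + 1)) ↦
      (⟨p.1, ofCoord x p.1 p.2⟩ : TangentBundle (𝓡 (N + 1)) M)) (z, u) := by
  set e := trivializationAt (EuclideanSpace ℝ (Fin (N + 1))) (TangentSpace (𝓡 (N + 1))) x
  have he : e.baseSet ×ˢ (univ : Set (EuclideanSpace ℝ (Fin (N + 1)))) ∈ 𝓝 (z, u) :=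
    (e.open_baseSet.prod isOpen_univ).mem_nhds ⟨by simpa [e] using hz, mem_univ _⟩
  refine (e.continuousOn_symm.continuousAt he).congr ?_
  filter_upwards [he] with p hp
  exact congrArg (Bundle.TotalSpace.mk p.1)
    (Bundle.Trivialization.symmL_apply (R := ℝ) e hp.1 p.2).symm

lemma continuousAt_form_ofCoord
    (hz : z ∈ (chartAt (EuclideanSpace ℝ (Fin (N + 1))) x).source)
    (u : EuclideanSpace ℝ (Fin (N + 1))) :
    ContinuousAt (fun p : M × EuclideanSpace ℝ (Fin (N + 1)) ↦
      g.form p.1 (ofCoord x p.1 p.2) (ofCoord x p.1 p.2)) (z, u) := by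
  have h := continuousAt_ofCoord hz u
  have : ContinuousAt (fun p : M × EuclideanSpace ℝ (Fin (N + 1)) ↦
      Bundle.TotalSpace.mk' ℝ (E := Bundle.Trivial M ℝ) p.1
        (g.form p.1 (ofCoord x p.1 p.2) (ofCoord x p.1 p.2))) (z, u) :=
    (ContinuousAt.comp (f := Prod.fst) (x := (z, u)) g.contMDiff.continuous.continuousAt
      continuousAt_fst).clm_bundle_apply₂
      (F₁ := EuclideanSpace ℝ (Fin (N + 1))) (F₂ := EuclideanSpace ℝ (Fin (N + 1))) h h
  simp only [FiberBundle.continuousAt_totalSpace] at this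
  exact this.2

lemma continuousAt_differential_ofCoord (hτ : ContMDiff (𝓡 (N + 1)) 𝓘(ℝ, ℝ) ∞ τ)
    (hz : z ∈ (chartAt (EuclideanSpace ℝ (Fin (N + 1))) x).source)
    (u : EuclideanSpace ℝ (Fin (N + 1))) :
    ContinuousAt (fun p : M × EuclideanSpace ℝ (Fin (N + 1)) ↦
      differential τ p.1 (ofCoord x p.1 p.2)) (z, u) :=
  ((contMDiff_snd_tangentBundle_modelSpace ℝ 𝓘(ℝ, ℝ) (n := 0)).continuous.comp
    (hτ.continuous_tangentMap (by simp))).continuousAt.comp (continuousAt_ofCoord hz u)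

end Coordinates

/-! ### Uniform estimates on future causal cones, and their duality -/

section Cones

variable {x z₀ : M}

lemma differential_ne_zero_of_causal (hτ : IsTemporal T τ) {z : M}
    {v : TangentSpace (𝓡 (N + 1)) z} (hv0 : v ≠ 0) (hv : g.form z v v ≤ 0) :
    differential τ z v ≠ 0 := by
  obtain ⟨n, hn, hnn, -⟩ := hτ.2 z
  rw [show differential τ z v = g.form z n v from (hn v).symm]
  exact form_ne_zero_of_causal hnn hv0 hv

/-- A function of tangent vectors, positively homogeneous in coordinates, which is positive on the
future causal cone at one point is bounded below by a multiple of the norm on all nearby future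
causal cones. -/
lemma exists_mul_norm_le_of_causal (hτ : IsTemporal T τ)
    (hz₀ : z₀ ∈ (chartAt (EuclideanSpace ℝ (Fin (N + 1))) x).source)
    (f : M → EuclideanSpace ℝ (Fin (N + 1)) →L[ℝ] ℝ)
    (hf : ∀ u, ContinuousAt (fun p : M × EuclideanSpace ℝ (Fin (N + 1)) ↦ f p.1 p.2) (z₀, u))
    (hpos : ∀ v : TangentSpace (𝓡 (N + 1)) z₀, IsFutureCausal T z₀ v → 0 < f z₀ (coord x z₀ v)) :
    ∃ c > 0, ∀ᶠ z in 𝓝 z₀, ∀ v : TangentSpace (𝓡 (N + 1)) z, IsFutureCausal T z v →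
      c * ‖coord x z v‖ ≤ f z (coord x z v) := by
  -- The real parameter is the future constant `c`. Each unit vector is spacelike, has dτ < 0, or is
  -- future causal at `z₀`; in each case an open condition persists nearby.
  have key : ∀ᶠ p in 𝓝 ((0 : ℝ), z₀), ∀ u ∈ Metric.sphere (0 : EuclideanSpace ℝ (Fin (N + 1))) 1,
      g.form p.2 (ofCoord x p.2 u) (ofCoord x p.2 u) ≤ 0 →
      0 ≤ differential τ p.2 (ofCoord x p.2 u) → p.1 < f p.2 u := by
    refine (isCompact_sphere _ _).eventually_forall_of_forall_eventually fun u hu ↦ ?_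
    have hc : ContinuousAt (fun q : (ℝ × M) × EuclideanSpace ℝ (Fin (N + 1)) ↦ (q.1.2, q.2))
      ((0, z₀), u) := by fun_prop
    have hG := ContinuousAt.comp (f := fun q : (ℝ × M) × EuclideanSpace ℝ (Fin (N + 1)) ↦
      (q.1.2, q.2)) (x := ((0, z₀), u)) (continuousAt_form_ofCoord (g := g) hz₀ u) hc
    have hD := ContinuousAt.comp (f := fun q : (ℝ × M) × EuclideanSpace ℝ (Fin (N + 1)) ↦
      (q.1.2, q.2)) (x := ((0, z₀), u)) (continuousAt_differential_ofCoord hτ.1 hz₀ u) hc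
    have hF := ContinuousAt.comp (f := fun q : (ℝ × M) × EuclideanSpace ℝ (Fin (N + 1)) ↦
      (q.1.2, q.2)) (x := ((0, z₀), u)) (hf u) hc
    by_cases h1 : 0 < g.form z₀ (ofCoord x z₀ u) (ofCoord x z₀ u)
    · filter_upwards [hG.eventually (lt_mem_nhds h1)] with q hq hq'
      exact absurd hq' (not_le.mpr hq)
    by_cases h2 : differential τ z₀ (ofCoord x z₀ u) < 0
    · filter_upwards [hD.eventually (gt_mem_nhds h2)] with q hq _ hq'
      exact absurd hq' (not_le.mpr hq)
    rw [not_lt] at h1 h2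
    have hu0 : ofCoord x z₀ u ≠ 0 := fun h ↦ by
      have := coord_ofCoord hz₀ u
      rw [h, map_zero] at this
      rw [← this] at hu
      simp at hu
    have h3 := hpos _ ((isFutureCausal_iff hτ).mpr
      ⟨hu0, h1, h2.lt_of_ne (differential_ne_zero_of_causal hτ hu0 h1).symm⟩)
    rw [coord_ofCoord hz₀] at h3
    have hfst : ContinuousAt (fun q : (ℝ × M) × EuclideanSpace ℝ (Fin (N + 1)) ↦ q.1.1)
      ((0, z₀), u) := by fun_prop
    filter_upwards [hfst.eventually_lt hF h3] with q hq _ _ using hq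
  obtain ⟨c, hc, hcpos⟩ := ((key.curry_nhds.filter_mono nhdsWithin_le_nhds).and
    (self_mem_nhdsWithin : Ioi (0 : ℝ) ∈ 𝓝[>] 0)).exists
  refine ⟨c, hcpos, ?_⟩
  filter_upwards [hc, (chartAt (EuclideanSpace ℝ (Fin (N + 1))) x).open_source.mem_nhds hz₀]
    with z hz hzs v hv
  obtain ⟨hv0, hvv, hvd⟩ := (isFutureCausal_iff hτ).mp hv
  have hu0 : coord x z v ≠ 0 := fun h ↦ hv0 (by rw [← ofCoord_coord hzs v, h, map_zero])
  have hn : 0 < ‖coord x z v‖ := norm_pos_iff.mpr hu0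
  have := hz (‖coord x z v‖⁻¹ • coord x z v) (by simp [norm_smul, hn.ne'])
  simp only [map_smul, smul_apply, smul_eq_mul, ofCoord_coord hzs] at this
  have h := this (by have := inv_pos.mpr hn; nlinarith [mul_pos this this]) (by positivity)
  rw [← div_eq_inv_mul, lt_div_iff₀ hn] at h
  exact h.le

/-- dτ is itself positive on the future cone, so the slices dτ = 1 of nearby cones are uniformly
bounded. -/
lemma exists_norm_coord_le (hτ : IsTemporal T τ) (x : M) :
    ∃ C > 0, ∀ᶠ z in 𝓝 x, ∀ v : TangentSpace (𝓡 (N + 1)) z, IsFutureCausal T z v →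
      ‖coord x z v‖ ≤ C * differential τ z v := by
  have hx := mem_chart_source (EuclideanSpace ℝ (Fin (N + 1))) x
  obtain ⟨c, hc, h⟩ := exists_mul_norm_le_of_causal hτ hx
    (fun z ↦ (differential τ z).comp (ofCoord x z)) (continuousAt_differential_ofCoord hτ.1 hx)
    (fun v hv ↦ by
      have := ((isFutureCausal_iff hτ).mp hv).2.2
      simpa [ofCoord_coord hx] using this)
  refine ⟨c⁻¹, by positivity, ?_⟩
  filter_upwards [h, chart_source_mem_nhds (EuclideanSpace ℝ (Fin (N + 1))) x] with z hz hzs v hv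
  have := hz v hv
  rw [ContinuousLinearMap.comp_apply, ofCoord_coord hzs] at this
  rwa [← div_eq_inv_mul, le_div_iff₀ hc, mul_comm]

/-- Strict negativity is uniform on unit causal vectors and so survives moving the base point. This
carries a covector from a limit point to the approximating curves. -/
lemma eventually_nonpos_of_causal (hτ : IsTemporal T τ)
    (hz₀ : z₀ ∈ (chartAt (EuclideanSpace ℝ (Fin (N + 1))) x).source)
    (ℓ : EuclideanSpace ℝ (Fin (N + 1)) →L[ℝ] ℝ)
    (hneg : ∀ v : TangentSpace (𝓡 (N + 1)) z₀, IsFutureCausal T z₀ v → ℓ (coord x z₀ v) < 0) :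
    ∀ᶠ z in 𝓝 z₀, ∀ v : TangentSpace (𝓡 (N + 1)) z, IsFutureCausal T z v →
      ℓ (coord x z v) ≤ 0 := by
  obtain ⟨c, hc, h⟩ := exists_mul_norm_le_of_causal hτ hz₀ (fun _ ↦ -ℓ) (fun u ↦ by fun_prop)
    (fun v hv ↦ by simpa using hneg v hv)
  filter_upwards [h] with z hz v hv
  have := hz v hv
  simp only [neg_apply] at this
  nlinarith [mul_nonneg hc.le (norm_nonneg (coord x z v))]

/-- A vector is future causal as soon as `τ` increases in its direction and it satisfies the linear
inequalities that are strict on the future causal cone. -/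
lemma isFutureCausal_of_forall_dual (hτ : IsTemporal T τ)
    (hz₀ : z₀ ∈ (chartAt (EuclideanSpace ℝ (Fin (N + 1))) x).source)
    {w : TangentSpace (𝓡 (N + 1)) z₀} (hw : 0 < differential τ z₀ w)
    (h : ∀ ℓ : EuclideanSpace ℝ (Fin (N + 1)) →L[ℝ] ℝ,
      (∀ v : TangentSpace (𝓡 (N + 1)) z₀, IsFutureCausal T z₀ v → ℓ (coord x z₀ v) < 0) →
      ℓ (coord x z₀ w) ≤ 0) : IsFutureCausal T z₀ w := by
  refine (isFutureCausal_iff hτ).mpr ⟨by rintro rfl; simp at hw, ?_, hw⟩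
  obtain ⟨n, hn, hnn, -⟩ := hτ.2 z₀
  have hn' (v : TangentSpace (𝓡 (N + 1)) z₀) : differential τ z₀ v = g.form z₀ n v := (hn v).symm
  -- It suffices to test with g(m,·) for future timelike m; by the sign rule these covectors are
  -- negative on the future cone.
  refine causal_of_forall_timelike hnn (by rwa [← hn']) fun m hmm hnm ↦ ?_
  have := h ((g.form z₀ m).comp (ofCoord x z₀)) fun v hv ↦ by
    obtain ⟨hv0, hvv, hvd⟩ := (isFutureCausal_iff hτ).mp hv
    rw [hn'] at hvd
    rw [ContinuousLinearMap.comp_apply, ofCoord_coord hz₀]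
    have h3 := form_mul_form_mul_form_neg hnn hmm hv0 hvv
    by_contra! hc
    exact h3.not_ge (by positivity)
  rwa [ContinuousLinearMap.comp_apply, ofCoord_coord hz₀] at this

end Cones

end

section

variable {N : ℕ} {M : Type*} [TopologicalSpace M]
  [ChartedSpace (EuclideanSpace ℝ (Fin (N + 1))) M]

/-! ### Locally Lipschitz curves -/

section LocLipschitz

variable {γ : ℝ → M} {a b c t : ℝ} {s s' : Set ℝ}

lemma IsLocLipschitzOn.mono (h : IsLocLipschitzOn N γ s) (hs : s' ⊆ s) :
    IsLocLipschitzOn N γ s' :=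
  ⟨h.1.mono hs, fun t ht ↦ by
    obtain ⟨K, u, hu, hK⟩ := h.2 t (hs ht)
    exact ⟨K, u, nhdsWithin_mono t hs hu, hK⟩⟩

lemma isLocLipschitzOn_singleton : IsLocLipschitzOn N γ {a} :=
  ⟨continuousOn_singleton γ a, fun t ht ↦ by
    obtain rfl := ht
    exact ⟨0, {t}, self_mem_nhdsWithin, by simp [LipschitzOnWith]⟩⟩

/-- Distances on the line add up through `b`, so splitting an increment there costs only the larger
constant. -/
lemma _root_.LipschitzOnWith.union_of_le {X : Type*} [PseudoMetricSpace X] {f : ℝ → X} {K L : ℝ≥0}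
    {A B : Set ℝ} (hA : LipschitzOnWith K f A) (hB : LipschitzOnWith L f B) (hbA : b ∈ A)
    (hbB : b ∈ B) (hAb : ∀ x ∈ A, x ≤ b) (hBb : ∀ x ∈ B, b ≤ x) :
    LipschitzOnWith (max K L) f (A ∪ B) := by
  have hA' : LipschitzOnWith (max K L) f A := hA.weaken (le_max_left _ _)
  have hB' : LipschitzOnWith (max K L) f B := hB.weaken (le_max_right _ _)
  rw [lipschitzOnWith_iff_dist_le_mul] at hA' hB' ⊢
  have key : ∀ x ∈ A, ∀ y ∈ B, dist (f x) (f y) ≤ (max K L : ℝ≥0) * dist x y := by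
    intro x hx y hy
    refine (dist_triangle _ (f b) _).trans ((add_le_add (hA' x hx b hbA) (hB' b hbB y hy)).trans ?_)
    rw [← mul_add, Real.dist_eq, Real.dist_eq, Real.dist_eq, abs_of_nonpos, abs_of_nonpos,
      abs_of_nonpos] <;> linarith [hAb x hx, hBb y hy]
  rintro x (hx | hx) y (hy | hy)
  · exact hA' x hx y hy
  · exact key x hx y hy
  · rw [dist_comm, dist_comm x]; exact key y hy x hx
  · exact hB' x hx y hy

lemma IsLocLipschitzOn.union (hab : a ≤ b) (hbc : b ≤ c) (h₁ : IsLocLipschitzOn N γ (Icc a b))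
    (h₂ : IsLocLipschitzOn N γ (Icc b c)) : IsLocLipschitzOn N γ (Icc a c) := by
  rw [← Icc_union_Icc_eq_Icc hab hbc]
  refine ⟨h₁.1.union_of_isClosed h₂.1 isClosed_Icc isClosed_Icc, fun t ht ↦ ?_⟩
  rw [nhdsWithin_union]
  rcases lt_trichotomy t b with htb | rfl | htb
  · have : 𝓝[Icc b c] t = ⊥ := by
      rw [← notMem_closure_iff_nhdsWithin_eq_bot, isClosed_Icc.closure_eq]
      exact fun h ↦ htb.not_ge h.1
    rw [this, sup_bot_eq]
    exact h₁.2 t (ht.resolve_right fun h ↦ htb.not_ge h.1)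
  · obtain ⟨K, u, hu, hK⟩ := h₁.2 t ⟨hab, le_rfl⟩
    obtain ⟨L, v, hv, hL⟩ := h₂.2 t ⟨le_rfl, hbc⟩
    refine ⟨max K L, (u ∩ Icc a t) ∪ (v ∩ Icc t c), ?_, ?_⟩
    · exact union_mem_sup (inter_mem hu self_mem_nhdsWithin) (inter_mem hv self_mem_nhdsWithin)
    · refine LipschitzOnWith.union_of_le (hK.mono inter_subset_left) (hL.mono inter_subset_left)
        ⟨mem_of_mem_nhdsWithin (right_mem_Icc.mpr hab) hu, hab, le_rfl⟩
        ⟨mem_of_mem_nhdsWithin (left_mem_Icc.mpr hbc) hv, le_rfl, hbc⟩ (fun x hx ↦ hx.2.2) fun x hx ↦ hx.2.1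
  · have : 𝓝[Icc a b] t = ⊥ := by
      rw [← notMem_closure_iff_nhdsWithin_eq_bot, isClosed_Icc.closure_eq]
      exact fun h ↦ htb.not_ge h.2
    rw [this, bot_sup_eq]
    exact h₂.2 t (ht.resolve_left fun h ↦ htb.not_ge h.2)

lemma IsLocLipschitzOn.locallyLipschitzOn_comp [IsManifold (𝓡 (N + 1)) ∞ M]
    {F : Type*} [NormedAddCommGroup F] [NormedSpace ℝ F]
    {f : M → F} (h : IsLocLipschitzOn N γ s)
    (hf : ∀ t ∈ s, ContMDiffAt (𝓡 (N + 1)) 𝓘(ℝ, F) 1 f (γ t)) : LocallyLipschitzOn s (f ∘ γ) := by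
  intro t ht
  obtain ⟨K, u, hu, hK⟩ := h.2 t ht
  set φ := extChartAt (𝓡 (N + 1)) (γ t)
  have h1 : ContDiffAt ℝ 1 (f ∘ φ.symm) (φ (γ t)) := by
    have := (contMDiffAt_iff.mp (hf t ht)).2
    simpa [contDiffWithinAt_univ, chartAt_self_eq, φ] using this
  obtain ⟨L, w, hw, hL⟩ := h1.exists_lipschitzOnWith
  have hcont : ContinuousWithinAt (φ ∘ γ) s t :=
    (continuousAt_extChartAt (I := 𝓡 (N + 1)) (γ t)).comp_continuousWithinAt (h.1 t ht)
  refine ⟨L * K, u ∩ ((φ ∘ γ) ⁻¹' w ∩ γ ⁻¹' φ.source), inter_mem hu (inter_mem (hcont hw)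
    (h.1 t ht (extChartAt_source_mem_nhds _))), ?_⟩
  have h2 : LipschitzOnWith (L * K) ((f ∘ φ.symm) ∘ (φ ∘ γ))
      (u ∩ ((φ ∘ γ) ⁻¹' w ∩ γ ⁻¹' φ.source)) :=
    hL.comp (hK.mono inter_subset_left) fun x hx ↦ hx.2.1
  intro x hx y hy
  have := h2 hx hy
  simpa only [Function.comp_apply, φ.left_inv hx.2.2, φ.left_inv hy.2.2] using this

/-- By compactness the local Lipschitz constants become one. Absolute continuity lets velocity
conditions holding only almost everywhere be integrated. -/
lemma IsLocLipschitzOn.absolutelyContinuousOnInterval_comp [IsManifold (𝓡 (N + 1)) ∞ M]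
    {F : Type*} [NormedAddCommGroup F] [NormedSpace ℝ F]
    {f : M → F} (hab : a ≤ b) (h : IsLocLipschitzOn N γ (Icc a b))
    (hf : ∀ t ∈ Icc a b, ContMDiffAt (𝓡 (N + 1)) 𝓘(ℝ, F) 1 f (γ t)) :
    AbsolutelyContinuousOnInterval (f ∘ γ) a b := by
  obtain ⟨K, hK⟩ := (h.locallyLipschitzOn_comp hf).exists_lipschitzOnWith_of_compact isCompact_Icc
  rw [← uIcc_of_le hab] at hK
  exact hK.absolutelyContinuousOnInterval

lemma hasDerivAt_comp_velocity {F : Type*} [NormedAddCommGroup F] [NormedSpace ℝ F]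
    {f : M → F} (hγ : MDifferentiableAt 𝓘(ℝ, ℝ) (𝓡 (N + 1)) γ t)
    (hf : MDifferentiableAt (𝓡 (N + 1)) 𝓘(ℝ, F) f (γ t)) :
    HasDerivAt (f ∘ γ) (mfderiv (𝓡 (N + 1)) 𝓘(ℝ, F) f (γ t) (velocity N γ t)) t := by
  have h := hf.hasMFDerivAt.comp t hγ.hasMFDerivAt
  set A : EuclideanSpace ℝ (Fin (N + 1)) →L[ℝ] F := mfderiv (𝓡 (N + 1)) 𝓘(ℝ, F) f (γ t)
  set B : ℝ →L[ℝ] EuclideanSpace ℝ (Fin (N + 1)) := mfderiv 𝓘(ℝ, ℝ) (𝓡 (N + 1)) γ t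
  have h' : HasFDerivAt (f ∘ γ) (A.comp B) t := hasMFDerivAt_iff_hasFDerivAt.mp h
  exact h'.hasDerivAt

end LocLipschitz

/-! ### Causal curves without a fixed time direction -/

section CausalCurve

variable [IsManifold (𝓡 (N + 1)) ∞ M] {g : LorentzMetric N M} {T : TimeOrientation g} {τ : M → ℝ}
  {γ : ℝ → M} {a b c : ℝ}

/-- A locally Lipschitz curve whose velocity is almost everywhere causal, future or past. -/
def IsCausalCurve (T : TimeOrientation g) (γ : ℝ → M) (a b : ℝ) : Prop :=
  IsLocLipschitzOn N γ (Icc a b) ∧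
    ∀ᵐ t ∂(volume.restrict (Icc a b)), MDifferentiableAt 𝓘(ℝ, ℝ) (𝓡 (N + 1)) γ t ∧
      (IsFutureCausal T (γ t) (velocity N γ t) ∨ IsPastCausal T (γ t) (velocity N γ t))

lemma IsFutureCausalCurve.isCausalCurve (h : IsFutureCausalCurve T γ a b) :
    IsCausalCurve T γ a b :=
  ⟨h.1, h.2.mono fun _ ht ↦ ⟨ht.1, .inl ht.2⟩⟩

lemma IsPastCausalCurve.isCausalCurve (h : IsPastCausalCurve T γ a b) : IsCausalCurve T γ a b :=
  ⟨h.1, h.2.mono fun _ ht ↦ ⟨ht.1, .inr ht.2⟩⟩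

lemma IsCausalCurve.mono {a' b' : ℝ} (h : IsCausalCurve T γ a b) (hs : Icc a' b' ⊆ Icc a b) :
    IsCausalCurve T γ a' b' :=
  ⟨h.1.mono hs, ae_restrict_of_ae_restrict_of_subset hs h.2⟩

lemma IsCausalCurve.union (hab : a ≤ b) (hbc : b ≤ c) (h₁ : IsCausalCurve T γ a b)
    (h₂ : IsCausalCurve T γ b c) : IsCausalCurve T γ a c := by
  refine ⟨h₁.1.union hab hbc h₂.1, ?_⟩
  rw [← Icc_union_Icc_eq_Icc hab hbc, ae_restrict_union_iff]
  exact ⟨h₁.2, h₂.2⟩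

lemma isCausalCurve_self : IsCausalCurve T γ a a :=
  ⟨by rw [Icc_self]; exact isLocLipschitzOn_singleton, by simp⟩

lemma IsTemporal.mdifferentiableAt (hτ : IsTemporal T τ) (z : M) :
    MDifferentiableAt (𝓡 (N + 1)) 𝓘(ℝ, ℝ) τ z :=
  hτ.1.contMDiffAt.mdifferentiableAt (by simp)

lemma IsTemporal.absolutelyContinuousOnInterval_comp (hτ : IsTemporal T τ) (hab : a ≤ b)
    (h : IsLocLipschitzOn N γ (Icc a b)) : AbsolutelyContinuousOnInterval (τ ∘ γ) a b :=
  h.absolutelyContinuousOnInterval_comp hab fun _ _ ↦ hτ.1.contMDiffAt.of_le (by simp)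

lemma IsTemporal.deriv_comp (hτ : IsTemporal T τ) {t : ℝ}
    (ht : MDifferentiableAt 𝓘(ℝ, ℝ) (𝓡 (N + 1)) γ t) :
    deriv (τ ∘ γ) t = differential τ (γ t) (velocity N γ t) :=
  (hasDerivAt_comp_velocity ht (hτ.mdifferentiableAt _)).deriv

lemma IsFutureCausalCurve.integral_abs_deriv (hτ : IsTemporal T τ) (hab : a ≤ b)
    (h : IsFutureCausalCurve T γ a b) :
    ∫ t in a..b, |deriv (τ ∘ γ) t| = τ (γ b) - τ (γ a) := by
  rw [← Function.comp_apply (f := τ), ← Function.comp_apply (f := τ) (x := a),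
    ← (hτ.absolutelyContinuousOnInterval_comp hab h.1).integral_deriv_eq_sub]
  refine intervalIntegral.integral_congr_ae_restrict ?_
  rw [uIoc_of_le hab]
  filter_upwards [ae_restrict_of_ae_restrict_of_subset Ioc_subset_Icc_self h.2] with t ht
  rw [hτ.deriv_comp ht.1, abs_of_pos ((isFutureCausal_iff hτ).mp ht.2).2.2]

lemma IsPastCausalCurve.integral_abs_deriv (hτ : IsTemporal T τ) (hab : a ≤ b)
    (h : IsPastCausalCurve T γ a b) :
    ∫ t in a..b, |deriv (τ ∘ γ) t| = τ (γ a) - τ (γ b) := by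
  rw [← neg_sub, ← Function.comp_apply (f := τ), ← Function.comp_apply (f := τ) (x := a),
    ← (hτ.absolutelyContinuousOnInterval_comp hab h.1).integral_deriv_eq_sub,
    ← intervalIntegral.integral_neg]
  refine intervalIntegral.integral_congr_ae_restrict ?_
  rw [uIoc_of_le hab]
  filter_upwards [ae_restrict_of_ae_restrict_of_subset Ioc_subset_Icc_self h.2] with t ht
  have := ((isFutureCausal_iff hτ).mp (isPastCausal_iff_neg.mp ht.2)).2.2
  rw [map_neg, neg_pos] at this
  rw [hτ.deriv_comp ht.1, abs_of_neg this]

lemma integral_abs_deriv_nonneg {f : ℝ → ℝ} (hab : a ≤ b) : 0 ≤ ∫ t in a..b, |deriv f t| :=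
  intervalIntegral.integral_nonneg hab fun _ _ ↦ abs_nonneg _

lemma IsCausalCurve.intervalIntegrable_deriv (hτ : IsTemporal T τ) (hab : a ≤ b)
    (h : IsCausalCurve T γ a b) : IntervalIntegrable (deriv (τ ∘ γ)) volume a b :=
  (hτ.absolutelyContinuousOnInterval_comp hab h.1).intervalIntegrable_deriv

/-- A piecewise causal path is a single causal curve, whose null length is an integral. -/
lemma PiecewiseCausalPath.isCausalCurve_and_nullLength (hτ : IsTemporal T τ) {p q : M}
    (β : PiecewiseCausalPath T p q) :
    IsCausalCurve T β.toFun (β.s 0) (β.s (Fin.last β.k)) ∧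
      ∫ t in β.s 0..β.s (Fin.last β.k), |deriv (τ ∘ β.toFun) t| = β.nullLength τ := by
  set f := β.toFun
  have key : ∀ m : ℕ, ∀ hm : m < β.k + 1, IsCausalCurve T f (β.s 0) (β.s ⟨m, hm⟩) ∧
      ∫ t in β.s 0..β.s ⟨m, hm⟩, |deriv (τ ∘ f) t| = ∑ i : Fin m,
        |τ (f (β.s ⟨i + 1, by omega⟩)) - τ (f (β.s ⟨i, by omega⟩))| := by
    intro m
    induction m with
    | zero => exact fun _ ↦ ⟨isCausalCurve_self, by simp⟩
    | succ m ih =>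
      intro hm
      obtain ⟨h1, h2⟩ := ih (by omega)
      have hle0 : β.s 0 ≤ β.s ⟨m, by omega⟩ := β.strictMono.monotone (Fin.zero_le _)
      have hle1 : β.s ⟨m, by omega⟩ ≤ β.s ⟨m + 1, hm⟩ :=
        β.strictMono.monotone (Fin.mk_le_mk.mpr (by omega))
      have h3 : IsCausalCurve T f (β.s ⟨m, by omega⟩) (β.s ⟨m + 1, hm⟩) ∧
          ∫ t in β.s ⟨m, by omega⟩..β.s ⟨m + 1, hm⟩, |deriv (τ ∘ f) t| =
            |τ (f (β.s ⟨m + 1, hm⟩)) - τ (f (β.s ⟨m, by omega⟩))| := by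
        -- The integral over a piece is plus or minus the increment of τ; being nonnegative, it is
        -- the absolute value.
        have h0 := integral_abs_deriv_nonneg (f := τ ∘ f) hle1
        rcases β.causal ⟨m, by omega⟩ with h | h
        · have hi := h.integral_abs_deriv hτ hle1
          exact ⟨h.isCausalCurve, by rw [hi] at h0 ⊢; exact (abs_of_nonneg h0).symm⟩
        · have hi := h.integral_abs_deriv hτ hle1
          exact ⟨h.isCausalCurve, by rw [hi] at h0 ⊢; rw [abs_sub_comm]; exact (abs_of_nonneg h0).symm⟩
      refine ⟨h1.union hle0 hle1 h3.1, ?_⟩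
      rw [← intervalIntegral.integral_add_adjacent_intervals
        (h1.intervalIntegrable_deriv hτ hle0).abs (h3.1.intervalIntegrable_deriv hτ hle1).abs,
        h2, h3.2, Fin.sum_univ_castSucc]
      rfl
  exact key β.k (by omega)

end CausalCurve

end

section

/-! ### Real functions: integral inequalities and first hitting times -/

section Real

variable {f h : ℝ → ℝ} {a b u v : ℝ}

lemma _root_.AbsolutelyContinuousOnInterval.sub_le_integral_of_deriv_le {G : ℝ → ℝ} (hab : a ≤ b)
    (hf : AbsolutelyContinuousOnInterval f a b) (hG : IntervalIntegrable G volume a b)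
    (hle : ∀ᵐ t ∂(volume.restrict (Icc a b)), deriv f t ≤ G t) :
    f b - f a ≤ ∫ t in a..b, G t := by
  rw [← hf.integral_deriv_eq_sub]
  exact intervalIntegral.integral_mono_ae_restrict hab hf.intervalIntegrable_deriv hG hle

lemma _root_.AbsolutelyContinuousOnInterval.sub_le_integral_abs_deriv (hab : a ≤ b)
    (hf : AbsolutelyContinuousOnInterval f a b) : f b - f a ≤ ∫ t in a..b, |deriv f t| :=
  hf.sub_le_integral_of_deriv_le hab hf.intervalIntegrable_deriv.abs
    (Eventually.of_forall fun _ ↦ le_abs_self _)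

/-- The excess of the variation over the increment is monotone in the interval. -/
lemma _root_.AbsolutelyContinuousOnInterval.integral_abs_deriv_le {ε : ℝ} (hau : a ≤ u)
    (huv : u ≤ v) (hvb : v ≤ b) (hf : AbsolutelyContinuousOnInterval f a b)
    (hε : ∫ t in a..b, |deriv f t| ≤ f b - f a + ε) :
    ∫ t in u..v, |deriv f t| ≤ f v - f u + ε := by
  have sub : ∀ {c d}, a ≤ c → c ≤ d → d ≤ b → AbsolutelyContinuousOnInterval f c d := by
    intro c d hac hcd hdb
    refine hf.mono ?_
    rw [uIcc_of_le hcd, uIcc_of_le (hac.trans (hcd.trans hdb))]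
    exact Icc_subset_Icc hac hdb
  have h1 := sub le_rfl hau (huv.trans hvb)
  have h2 := sub hau huv hvb
  have h3 := sub (hau.trans huv) hvb le_rfl
  rw [← intervalIntegral.integral_add_adjacent_intervals (b := v)
      (sub le_rfl (hau.trans huv) hvb).intervalIntegrable_deriv.abs h3.intervalIntegrable_deriv.abs,
    ← intervalIntegral.integral_add_adjacent_intervals (b := u)
      h1.intervalIntegrable_deriv.abs h2.intervalIntegrable_deriv.abs] at hε
  linarith [h1.sub_le_integral_abs_deriv hau, h3.sub_le_integral_abs_deriv hvb]

/-- First hitting times of the levels of a continuous function. -/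
lemma exists_hitting_times (hab : a ≤ b) (hh : ContinuousOn h (Icc a b)) :
    ∃ σ : ℝ → ℝ, (∀ t ∈ Icc (h a) (h b), σ t ∈ Icc a b ∧ h (σ t) = t) ∧
      MonotoneOn σ (Icc (h a) (h b)) ∧ (h a ≤ h b → σ (h a) = a) := by
  -- Superlevel sets shrink as `t` grows, which makes their least elements monotone; the
  -- intermediate value theorem then puts these at level `t` exactly.
  have key : ∀ t : ℝ, ∃ s, t ∈ Icc (h a) (h b) → IsLeast (Icc a b ∩ h ⁻¹' Ici t) s := by
    intro t
    by_cases ht : t ∈ Icc (h a) (h b)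
    · have hcl : IsClosed (Icc a b ∩ h ⁻¹' Ici t) :=
        hh.preimage_isClosed_of_isClosed isClosed_Icc isClosed_Ici
      obtain ⟨s, hs⟩ := (isCompact_Icc.of_isClosed_subset hcl inter_subset_left).exists_isLeast
        ⟨b, right_mem_Icc.mpr hab, ht.2⟩
      exact ⟨s, fun _ ↦ hs⟩
    · exact ⟨0, fun h ↦ absurd h ht⟩
  choose σ hσ using key
  refine ⟨σ, fun t ht ↦ ⟨(hσ t ht).1.1, ?_⟩, fun t ht t' ht' htt' ↦
    (hσ t ht).2 ⟨(hσ t' ht').1.1, htt'.trans (hσ t' ht').1.2⟩, fun hle ↦ ?_⟩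
  · have hs := (hσ t ht).1
    obtain ⟨s', hs', rfl⟩ := intermediate_value_Icc hs.1.1
      (hh.mono (Icc_subset_Icc_right hs.1.2)) ⟨ht.1, hs.2⟩
    have := (hσ _ ht).2 ⟨⟨hs'.1, hs'.2.trans hs.1.2⟩, le_rfl (a := h s')⟩
    exact congrArg h (le_antisymm this hs'.2)
  · have := hσ (h a) ⟨le_rfl, hle⟩
    exact le_antisymm (this.2 ⟨left_mem_Icc.mpr hab, le_rfl (a := h a)⟩) this.1.1.1

end Real

variable {N : ℕ} {M : Type*} [TopologicalSpace M]
  [ChartedSpace (EuclideanSpace ℝ (Fin (N + 1))) M]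

/-- The ball of radius `r` around `x` in the coordinates of the chart at `x`. -/
def chartBall (N : ℕ) {M : Type*} [TopologicalSpace M]
    [ChartedSpace (EuclideanSpace ℝ (Fin (N + 1))) M] (x : M) (r : ℝ) : Set M :=
  (chartAt (EuclideanSpace ℝ (Fin (N + 1))) x).source ∩
    extChartAt (𝓡 (N + 1)) x ⁻¹' Metric.ball (extChartAt (𝓡 (N + 1)) x x) r

lemma isOpen_chartBall (x : M) (r : ℝ) : IsOpen (chartBall N x r) := by
  rw [chartBall, ← extChartAt_source (𝓡 (N + 1))]
  exact (continuousOn_extChartAt x).isOpen_inter_preimage (isOpen_extChartAt_source x)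
    Metric.isOpen_ball

lemma chartBall_mem_nhds (x : M) {r : ℝ} (hr : 0 < r) : chartBall N x r ∈ 𝓝 x :=
  (isOpen_chartBall x r).mem_nhds ⟨mem_chart_source _ x, Metric.mem_ball_self hr⟩

variable [IsManifold (𝓡 (N + 1)) ∞ M]
  {g : LorentzMetric N M} {T : TimeOrientation g} {τ : M → ℝ} {x : M} {γ : ℝ → M} {a b : ℝ}

/-! ### Estimates along causal curves -/

section Estimates

/-- On `R`, which lies in the domain of the chart at `x`, coordinates of future causal vectors are
bounded by `C` times the increase of `τ`. -/
structure IsAdapted (T : TimeOrientation g) (τ : M → ℝ) (x : M) (C : ℝ) (R : Set M) : Prop where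
  pos : 0 < C
  subset_source : R ⊆ (chartAt (EuclideanSpace ℝ (Fin (N + 1))) x).source
  norm_le : ∀ z ∈ R, ∀ v : TangentSpace (𝓡 (N + 1)) z, IsFutureCausal T z v →
      ‖coord x z v‖ ≤ C * differential τ z v

lemma IsAdapted.mono {C : ℝ} {R R' : Set M} (hR : IsAdapted T τ x C R) (h : R' ⊆ R) :
    IsAdapted T τ x C R' :=
  ⟨hR.pos, h.trans hR.subset_source, fun z hz ↦ hR.norm_le z (h hz)⟩

variable {C : ℝ} {R : Set M} (ℓ : EuclideanSpace ℝ (Fin (N + 1)) →L[ℝ] ℝ)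

lemma IsLocLipschitzOn.absolutelyContinuousOnInterval_dual (hab : a ≤ b)
    (h : IsLocLipschitzOn N γ (Icc a b))
    (hR : ∀ t ∈ Icc a b, γ t ∈ (chartAt (EuclideanSpace ℝ (Fin (N + 1))) x).source) :
    AbsolutelyContinuousOnInterval ((ℓ ∘ extChartAt (𝓡 (N + 1)) x) ∘ γ) a b :=
  h.absolutelyContinuousOnInterval_comp hab fun t ht ↦
    ℓ.contMDiff.contMDiffAt.comp _ ((contMDiffAt_extChartAt' (hR t ht)).of_le le_rfl)

lemma deriv_dual_chart {t : ℝ} (ht : MDifferentiableAt 𝓘(ℝ, ℝ) (𝓡 (N + 1)) γ t)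
    (hR : γ t ∈ (chartAt (EuclideanSpace ℝ (Fin (N + 1))) x).source) :
    deriv ((ℓ ∘ extChartAt (𝓡 (N + 1)) x) ∘ γ) t = ℓ (coord x (γ t) (velocity N γ t)) := by
  have h := hasDerivAt_comp_velocity ht (mdifferentiableAt_extChartAt (I := 𝓡 (N + 1)) hR)
  rw [coord_eq_mfderiv hR]
  exact (ℓ.hasFDerivAt.comp_hasDerivAt t h).deriv

lemma IsCausalCurve.dual_sub_le (hτ : IsTemporal T τ) (hab : a ≤ b) (h : IsCausalCurve T γ a b)
    (hR : IsAdapted T τ x C R) (hγ : ∀ t ∈ Icc a b, γ t ∈ R) :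
    ℓ (extChartAt (𝓡 (N + 1)) x (γ b) - extChartAt (𝓡 (N + 1)) x (γ a)) ≤
      ‖ℓ‖ * C * ∫ t in a..b, |deriv (τ ∘ γ) t| := by
  have hac := h.1.absolutelyContinuousOnInterval_dual ℓ hab fun t ht ↦ hR.subset_source (hγ t ht)
  rw [map_sub, ← intervalIntegral.integral_const_mul]
  refine hac.sub_le_integral_of_deriv_le hab ((h.intervalIntegrable_deriv hτ hab).abs.const_mul _) ?_
  filter_upwards [h.2, ae_restrict_mem measurableSet_Icc] with t ht htm
  rw [deriv_dual_chart ℓ ht.1 (hR.subset_source (hγ t htm)), hτ.deriv_comp ht.1, mul_assoc]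
  refine (le_abs_self _).trans ((ℓ.le_opNorm _).trans (mul_le_mul_of_nonneg_left ?_ (norm_nonneg _)))
  rcases ht.2 with h1 | h1
  · exact (hR.norm_le _ (hγ t htm) _ h1).trans
      (mul_le_mul_of_nonneg_left (le_abs_self _) hR.pos.le)
  · have := hR.norm_le _ (hγ t htm) _ (isPastCausal_iff_neg.mp h1)
    rw [map_neg, norm_neg, map_neg] at this
    exact this.trans (mul_le_mul_of_nonneg_left (neg_le_abs _) hR.pos.le)

/-- A norming functional of the increment reduces the bound to the scalar estimate. -/
lemma IsCausalCurve.norm_sub_le (hτ : IsTemporal T τ) (hab : a ≤ b) (h : IsCausalCurve T γ a b)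
    (hR : IsAdapted T τ x C R) (hγ : ∀ t ∈ Icc a b, γ t ∈ R) :
    ‖extChartAt (𝓡 (N + 1)) x (γ b) - extChartAt (𝓡 (N + 1)) x (γ a)‖ ≤
      C * ∫ t in a..b, |deriv (τ ∘ γ) t| := by
  obtain ⟨ℓ, hℓ, hℓ'⟩ := exists_dual_vector'' ℝ
    (extChartAt (𝓡 (N + 1)) x (γ b) - extChartAt (𝓡 (N + 1)) x (γ a))
  have := h.dual_sub_le ℓ hτ hab hR hγ
  rw [hℓ', mul_assoc] at this
  exact this.trans (mul_le_of_le_one_left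
    (mul_nonneg hR.pos.le (integral_abs_deriv_nonneg hab)) hℓ)

/-- If a linear form is nonpositive on the future causal vectors along a causal curve, its
increment is controlled by the total decrease of `τ`. -/
lemma IsCausalCurve.dual_sub_le_of_nonpos (hτ : IsTemporal T τ) (hab : a ≤ b)
    (h : IsCausalCurve T γ a b) (hR : IsAdapted T τ x C R) (hγ : ∀ t ∈ Icc a b, γ t ∈ R)
    (hℓ : ∀ z ∈ R, ∀ v : TangentSpace (𝓡 (N + 1)) z, IsFutureCausal T z v → ℓ (coord x z v) ≤ 0) :
    ℓ (extChartAt (𝓡 (N + 1)) x (γ b) - extChartAt (𝓡 (N + 1)) x (γ a)) ≤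
      ‖ℓ‖ * C * ((∫ t in a..b, |deriv (τ ∘ γ) t|) - (τ (γ b) - τ (γ a))) := by
  have hac := h.1.absolutelyContinuousOnInterval_dual ℓ hab fun t ht ↦ hR.subset_source (hγ t ht)
  have hi := h.intervalIntegrable_deriv hτ hab
  rw [map_sub, ← Function.comp_apply (f := τ), ← Function.comp_apply (f := τ) (x := a),
    ← (hτ.absolutelyContinuousOnInterval_comp hab h.1).integral_deriv_eq_sub,
    ← intervalIntegral.integral_sub hi.abs hi, ← intervalIntegral.integral_const_mul]
  refine hac.sub_le_integral_of_deriv_le hab ((hi.abs.sub hi).const_mul _) ?_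
  filter_upwards [h.2, ae_restrict_mem measurableSet_Icc] with t ht htm
  have hC := mul_nonneg (norm_nonneg ℓ) hR.pos.le
  rw [deriv_dual_chart ℓ ht.1 (hR.subset_source (hγ t htm)), hτ.deriv_comp ht.1]
  -- On future velocities the left side is nonpositive and the right nonnegative; on past ones |dτ|
  -- - dτ = 2|dτ| dominates the speed bound.
  rcases ht.2 with h1 | h1
  · exact (hℓ _ (hγ t htm) _ h1).trans (mul_nonneg hC (sub_nonneg.mpr (le_abs_self _)))
  · have h1' := isPastCausal_iff_neg.mp h1
    have h2 := hR.norm_le _ (hγ t htm) _ h1'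
    have h3 := ((isFutureCausal_iff hτ).mp h1').2.2
    rw [map_neg] at h3
    rw [map_neg, norm_neg, map_neg] at h2
    refine (le_abs_self _).trans ((ℓ.le_opNorm _).trans ?_)
    rw [mul_assoc]
    refine mul_le_mul_of_nonneg_left (h2.trans (mul_le_mul_of_nonneg_left ?_ hR.pos.le))
      (norm_nonneg _)
    linarith [neg_le_abs (differential τ (γ t) (velocity N γ t))]

end Estimates

/-! ### Confinement to a coordinate ball -/

section ChartBall

lemma exists_isAdapted_chartBall (hτ : IsTemporal T τ) (x : M) :
    ∃ C r : ℝ, 0 < r ∧ IsAdapted T τ x C (chartBall N x r) ∧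
      Metric.closedBall (extChartAt (𝓡 (N + 1)) x x) r ⊆ (extChartAt (𝓡 (N + 1)) x).target := by
  obtain ⟨C, hC, h⟩ := exists_norm_coord_le (g := g) (T := T) hτ x
  have h1 : ∀ᶠ y in 𝓝 (extChartAt (𝓡 (N + 1)) x x),
      ∀ v : TangentSpace (𝓡 (N + 1)) ((extChartAt (𝓡 (N + 1)) x).symm y),
      IsFutureCausal T _ v → ‖coord x _ v‖ ≤ C * differential τ _ v := by
    refine (continuousAt_extChartAt_symm (I := 𝓡 (N + 1)) x).eventually (p := fun z ↦
      ∀ v : TangentSpace (𝓡 (N + 1)) z, IsFutureCausal T z v →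
        ‖coord x z v‖ ≤ C * differential τ z v) ?_
    rwa [extChartAt_to_inv]
  obtain ⟨ε, hε, hball⟩ := Metric.mem_nhds_iff.mp (inter_mem h1 (extChartAt_target_mem_nhds x))
  refine ⟨C, ε / 2, by positivity, ⟨hC, inter_subset_left, fun z hz ↦ ?_⟩,
    fun y hy ↦ (hball (Metric.closedBall_subset_ball (by linarith) hy)).2⟩
  have := (hball (Metric.ball_subset_ball (by linarith) hz.2)).1
  rw [← (extChartAt (𝓡 (N + 1)) x).left_inv (x := z) (by simpa using hz.1)]
  exact this

/-- A causal curve along which `τ` varies little stays in a coordinate ball. -/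
lemma IsCausalCurve.mem_chartBall [T2Space M] {C r : ℝ} (hτ : IsTemporal T τ) (hab : a ≤ b)
    (h : IsCausalCurve T γ a b) (hr : 0 < r) (hR : IsAdapted T τ x C (chartBall N x r))
    (htgt : Metric.closedBall (extChartAt (𝓡 (N + 1)) x x) r ⊆ (extChartAt (𝓡 (N + 1)) x).target)
    (ha : γ a ∈ chartBall N x (r / 4)) (hlen : C * ∫ t in a..b, |deriv (τ ∘ γ) t| ≤ r / 2) :
    ∀ t ∈ Icc a b, γ t ∈ chartBall N x r := by
  by_contra! hcon
  set φ := extChartAt (𝓡 (N + 1)) x with hφ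
  obtain ⟨t₁, ht₁, ht₁'⟩ := hcon
  have hcl : IsClosed (Icc a b ∩ γ ⁻¹' (chartBall N x r)ᶜ) :=
    h.1.1.preimage_isClosed_of_isClosed isClosed_Icc (isOpen_chartBall x r).isClosed_compl
  obtain ⟨t₀, ⟨ht₀, ht₀'⟩, hmin⟩ :=
    (isCompact_Icc.of_isClosed_subset hcl inter_subset_left).exists_isLeast ⟨t₁, ht₁, ht₁'⟩
  have hat : a < t₀ := by
    refine lt_of_le_of_ne ht₀.1 ?_
    rintro rfl
    exact ht₀' ⟨ha.1, Metric.ball_subset_ball (by linarith) ha.2⟩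
  have hK : IsCompact (φ.symm '' Metric.closedBall (φ x) (3 * r / 4)) :=
    (isCompact_closedBall _ _).image_of_continuousOn ((continuousOn_extChartAt_symm x).mono
      ((Metric.closedBall_subset_closedBall (by linarith)).trans htgt))
  have hmem : γ t₀ ∈ φ.symm '' Metric.closedBall (φ x) (3 * r / 4) := by
    have hnb : (𝓝[Ico a t₀] t₀).NeBot := by
      rw [← mem_closure_iff_nhdsWithin_neBot, closure_Ico hat.ne]
      exact right_mem_Icc.mpr hat.le
    refine hK.isClosed.mem_of_tendsto ((h.1.1 t₀ ht₀).mono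
      (Ico_subset_Icc_self.trans (Icc_subset_Icc_right ht₀.2))) ?_
    filter_upwards [self_mem_nhdsWithin] with t ht
    have hin : ∀ s ∈ Icc a t, γ s ∈ chartBall N x r := by
      intro s hs
      by_contra hns
      exact (hs.2.trans_lt ht.2).not_ge (hmin ⟨⟨hs.1, hs.2.trans (ht.2.le.trans ht₀.2)⟩, hns⟩)
    have htb : t ≤ b := ht.2.le.trans ht₀.2
    have h1 := (h.mono (Icc_subset_Icc_right htb)).norm_sub_le hτ ht.1 hR hin
    have h2 : ∫ t in a..t, |deriv (τ ∘ γ) t| ≤ ∫ t in a..b, |deriv (τ ∘ γ) t| :=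
      intervalIntegral.integral_mono_interval le_rfl ht.1 htb
        (Eventually.of_forall fun _ ↦ abs_nonneg _) (h.intervalIntegrable_deriv hτ hab).abs
    refine ⟨φ (γ t), ?_, φ.left_inv (by simpa [hφ] using (hin t (right_mem_Icc.mpr ht.1)).1)⟩
    have h3 := ha.2
    rw [mem_preimage, Metric.mem_ball, dist_eq_norm] at h3
    rw [Metric.mem_closedBall, dist_eq_norm]
    have h4 := norm_add_le (φ (γ t) - φ (γ a)) (φ (γ a) - φ x)
    rw [sub_add_sub_cancel] at h4
    linarith [mul_le_mul_of_nonneg_left h2 hR.pos.le]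
  obtain ⟨y, hy, hyt⟩ := hmem
  have hyt' : y ∈ φ.target := htgt (Metric.closedBall_subset_closedBall (by linarith) hy)
  refine ht₀' ⟨?_, ?_⟩
  · rw [← hyt]
    simpa [hφ] using φ.map_target hyt'
  · rw [mem_preimage, ← hyt, φ.right_inv hyt']
    exact Metric.closedBall_subset_ball (by linarith) hy

end ChartBall

/-! ### Sampling a causal curve at the levels of `τ` -/

/-- Here `z` is `γ` at first hitting times; it may jump, but the small excess variation controls the
jumps. The level τ (γ b) may be hit before `b`, so that endpoint is only approximate. The condition
with `ρ` keeps the whole arc between two samples where the sign of `ℓ` is known. -/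
lemma IsCausalCurve.exists_sampling [T2Space M] {C r ε : ℝ} (hτ : IsTemporal T τ) (hab : a ≤ b)
    (h : IsCausalCurve T γ a b) (hr : 0 < r) (hR : IsAdapted T τ x C (chartBall N x r))
    (htgt : Metric.closedBall (extChartAt (𝓡 (N + 1)) x x) r ⊆ (extChartAt (𝓡 (N + 1)) x).target)
    (ha : γ a ∈ chartBall N x (r / 4)) (hle : τ (γ a) ≤ τ (γ b))
    (hlen : ∫ t in a..b, |deriv (τ ∘ γ) t| ≤ τ (γ b) - τ (γ a) + ε)
    (hsmall : C * (τ (γ b) - τ (γ a) + ε) ≤ r / 2) :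
    ∃ z : ℝ → M, (∀ t ∈ Icc (τ (γ a)) (τ (γ b)), z t ∈ chartBall N x r ∧ τ (z t) = t) ∧
      z (τ (γ a)) = γ a ∧
      ‖extChartAt (𝓡 (N + 1)) x (γ b) - extChartAt (𝓡 (N + 1)) x (z (τ (γ b)))‖ ≤ C * ε ∧
      ∀ s ∈ Icc (τ (γ a)) (τ (γ b)), ∀ t ∈ Icc (τ (γ a)) (τ (γ b)), s ≤ t →
        ‖extChartAt (𝓡 (N + 1)) x (z t) - extChartAt (𝓡 (N + 1)) x (z s)‖ ≤ C * (t - s + ε) ∧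
        ∀ (ℓ : EuclideanSpace ℝ (Fin (N + 1)) →L[ℝ] ℝ) (y : EuclideanSpace ℝ (Fin (N + 1))) (ρ : ℝ),
          (∀ z' ∈ chartBall N x r, extChartAt (𝓡 (N + 1)) x z' ∈ Metric.ball y ρ →
            ∀ v : TangentSpace (𝓡 (N + 1)) z', IsFutureCausal T z' v → ℓ (coord x z' v) ≤ 0) →
          ‖extChartAt (𝓡 (N + 1)) x (z s) - y‖ + C * (t - s + ε) < ρ →
          ℓ (extChartAt (𝓡 (N + 1)) x (z t) - extChartAt (𝓡 (N + 1)) x (z s)) ≤ ‖ℓ‖ * C * ε := by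
  set φ := extChartAt (𝓡 (N + 1)) x
  have hin := h.mem_chartBall hτ hab hr hR htgt ha
    ((mul_le_mul_of_nonneg_left hlen hR.pos.le).trans hsmall)
  have hac := hτ.absolutelyContinuousOnInterval_comp hab h.1
  have hvar {u v : ℝ} (hau : a ≤ u) (huv : u ≤ v) (hvb : v ≤ b) :
      ∫ t in u..v, |deriv (τ ∘ γ) t| ≤ τ (γ v) - τ (γ u) + ε :=
    hac.integral_abs_deriv_le hau huv hvb hlen
  have hnorm {u v : ℝ} (hau : a ≤ u) (huv : u ≤ v) (hvb : v ≤ b) :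
      ‖φ (γ v) - φ (γ u)‖ ≤ C * (τ (γ v) - τ (γ u) + ε) :=
    ((h.mono (Icc_subset_Icc hau hvb)).norm_sub_le hτ huv hR fun t ht ↦
      hin t ⟨hau.trans ht.1, ht.2.trans hvb⟩).trans
      (mul_le_mul_of_nonneg_left (hvar hau huv hvb) hR.pos.le)
  obtain ⟨σ, hσ, hmono, hσa⟩ := exists_hitting_times hab (hτ.1.continuous.comp_continuousOn h.1.1)
  simp only [Function.comp_apply] at hσ hmono hσa
  refine ⟨γ ∘ σ, fun t ht ↦ ⟨hin _ (hσ t ht).1, (hσ t ht).2⟩, by simp [hσa hle], ?_, ?_⟩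
  · have hb := hσ _ (right_mem_Icc.mpr hle)
    have := hnorm hb.1.1 hb.1.2 le_rfl
    rwa [hb.2, sub_self, zero_add] at this
  intro s hs t ht hst
  obtain ⟨hs1, hs2⟩ := hσ s hs
  obtain ⟨ht1, ht2⟩ := hσ t ht
  have hle' := hmono hs ht hst
  refine ⟨by simpa only [hs2, ht2, Function.comp_apply] using hnorm hs1.1 hle' ht1.2, fun ℓ y ρ hℓ hρ ↦ ?_⟩
  have key := (h.mono (Icc_subset_Icc hs1.1 ht1.2)).dual_sub_le_of_nonpos ℓ hτ hle'
    (hR.mono (R' := {z' ∈ chartBall N x r | φ z' ∈ Metric.ball y ρ}) (sep_subset _ _))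
    (fun u hu ↦ ⟨hin u ⟨hs1.1.trans hu.1, hu.2.trans ht1.2⟩, ?_⟩) fun z' hz' ↦ hℓ z' hz'.1 hz'.2
  · refine key.trans (mul_le_mul_of_nonneg_left ?_ (mul_nonneg (norm_nonneg _) hR.pos.le))
    linarith [hvar hs1.1 hle' ht1.2]
  · have h1 := (h.mono (Icc_subset_Icc hs1.1 (hu.2.trans ht1.2))).norm_sub_le hτ hu.1 hR fun w hw ↦
      hin w ⟨hs1.1.trans hw.1, hw.2.trans (hu.2.trans ht1.2)⟩
    have h2 : ∫ w in σ s..u, |deriv (τ ∘ γ) w| ≤ ∫ w in σ s..σ t, |deriv (τ ∘ γ) w| :=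
      intervalIntegral.integral_mono_interval le_rfl hu.1 hu.2
        (Eventually.of_forall fun _ ↦ abs_nonneg _)
        ((h.mono (Icc_subset_Icc hs1.1 ht1.2)).intervalIntegrable_deriv hτ hle').abs
    have h3 := mul_le_mul_of_nonneg_left (h2.trans (hvar hs1.1 hle' ht1.2)) hR.pos.le
    rw [hs2, ht2] at h3
    rw [Metric.mem_ball, dist_eq_norm]
    have h4 := norm_add_le (φ (γ u) - φ (γ (σ s))) (φ (γ (σ s)) - y)
    rw [sub_add_sub_cancel] at h4
    simp only [Function.comp_apply] at hρ
    linarith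

end

section

variable {N : ℕ} {M : Type*} [TopologicalSpace M]
  [ChartedSpace (EuclideanSpace ℝ (Fin (N + 1))) M] [IsManifold (𝓡 (N + 1)) ∞ M]
  {g : LorentzMetric N M} {T : TimeOrientation g} {τ : M → ℝ} {x p q : M} {a b : ℝ}

/-! ### The limit curve -/

section Limit

/-- A Lipschitz curve in a chart, parametrized by `τ`, is future causal as soon as its forward
increments satisfy the dual inequalities of the future cones. -/
lemma isFutureCausalCurve_of_chart (hτ : IsTemporal T τ) {K : ℝ≥0}
    {c : ℝ → EuclideanSpace ℝ (Fin (N + 1))} (hK : LipschitzOnWith K c (Icc a b))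
    (hc : ∀ t ∈ Icc a b, c t ∈ (extChartAt (𝓡 (N + 1)) x).target)
    (hcτ : ∀ t ∈ Icc a b, τ ((extChartAt (𝓡 (N + 1)) x).symm (c t)) = t)
    (hdual : ∀ t ∈ Ioo a b, ∀ ℓ : EuclideanSpace ℝ (Fin (N + 1)) →L[ℝ] ℝ,
      (∀ v : TangentSpace (𝓡 (N + 1)) ((extChartAt (𝓡 (N + 1)) x).symm (c t)),
        IsFutureCausal T _ v → ℓ (coord x _ v) < 0) → ∀ᶠ s in 𝓝[>] t, ℓ (c s - c t) ≤ 0) :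
    IsFutureCausalCurve T ((extChartAt (𝓡 (N + 1)) x).symm ∘ c) a b := by
  set φ := extChartAt (𝓡 (N + 1)) x with hφ
  have hsymm (t : ℝ) (ht : t ∈ Icc a b) : ContMDiffAt 𝓘(ℝ, EuclideanSpace ℝ (Fin (N + 1)))
      (𝓡 (N + 1)) ∞ φ.symm (c t) :=
    (contMDiffOn_extChartAt_symm x).contMDiffAt ((isOpen_extChartAt_target x).mem_nhds (hc t ht))
  have hsource (t : ℝ) (ht : t ∈ Icc a b) :
      φ.symm (c t) ∈ (chartAt (EuclideanSpace ℝ (Fin (N + 1))) x).source := by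
    simpa [hφ] using φ.map_target (hc t ht)
  refine ⟨⟨(continuousOn_extChartAt_symm x).comp hK.continuousOn hc, fun t ht ↦ ?_⟩, ?_⟩
  · have h1 : ContDiffAt ℝ 1 (extChartAt (𝓡 (N + 1)) (φ.symm (c t)) ∘ φ.symm) (c t) := by
      rw [← contMDiffAt_iff_contDiffAt]
      exact (contMDiffAt_extChartAt (n := 1)).comp _ ((hsymm t ht).of_le (by simp))
    obtain ⟨L, w, hw, hL⟩ := h1.exists_lipschitzOnWith
    exact ⟨L * K, Icc a b ∩ c ⁻¹' w, inter_mem self_mem_nhdsWithin (hK.continuousOn t ht hw),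
      hL.comp (hK.mono inter_subset_left) fun s hs ↦ hs.2⟩
  · rw [ae_restrict_congr_set Ioo_ae_eq_Icc.symm]
    have hdiff : ∀ᵐ t ∂(volume.restrict (Ioo a b)), DifferentiableWithinAt ℝ c (Ioo a b) t :=
      (hK.mono Ioo_subset_Icc_self).ae_differentiableWithinAt_real measurableSet_Ioo
    filter_upwards [hdiff, ae_restrict_mem measurableSet_Ioo] with t htd ht
    have htI := Ioo_subset_Icc_self ht
    have hct : DifferentiableAt ℝ c t := htd.differentiableAt (Ioo_mem_nhds ht.1 ht.2)
    have hγ : MDifferentiableAt 𝓘(ℝ, ℝ) (𝓡 (N + 1)) (φ.symm ∘ c) t :=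
      ((hsymm t htI).mdifferentiableAt (by simp)).comp t hct.mdifferentiableAt
    refine ⟨hγ, ?_⟩
    have hcoord : coord x (φ.symm (c t)) (velocity N (φ.symm ∘ c) t) = deriv c t := by
      have h := (hasDerivAt_comp_velocity hγ
        (mdifferentiableAt_extChartAt (I := 𝓡 (N + 1)) (hsource t htI))).deriv
      rw [coord_eq_mfderiv (hsource t htI)]
      refine h.symm.trans (EventuallyEq.deriv_eq ?_)
      filter_upwards [Ioo_mem_nhds ht.1 ht.2] with s hs
      exact φ.right_inv (hc s (Ioo_subset_Icc_self hs))
    refine isFutureCausal_of_forall_dual (x := x) hτ (hsource t htI) ?_ fun ℓ hℓ ↦ ?_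
    -- Parametrization by τ gives dτ = 1 on the velocity; in particular it is nonzero.
    · have : τ ∘ (φ.symm ∘ c) =ᶠ[𝓝 t] id := by
        filter_upwards [Ioo_mem_nhds ht.1 ht.2] with s hs
        exact hcτ s (Ioo_subset_Icc_self hs)
      have h1 := hτ.deriv_comp hγ
      rw [this.deriv_eq, deriv_id] at h1
      exact h1 ▸ one_pos
    · refine (congrArg ℓ hcoord).trans_le ?_
      have h1 : Tendsto (slope (ℓ ∘ c) t) (𝓝[>] t) (𝓝 (ℓ (deriv c t))) :=
        (ℓ.hasFDerivAt.comp_hasDerivAt t hct.hasDerivAt).tendsto_slope.mono_left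
          (nhdsWithin_mono t fun s hs ↦ (ne_of_gt hs : s ≠ t))
      refine le_of_tendsto h1 ?_
      filter_upwards [hdual t ht ℓ hℓ, self_mem_nhdsWithin] with s hs hst
      rw [slope_def_field, Function.comp_apply, Function.comp_apply, ← map_sub]
      exact div_nonpos_of_nonpos_of_nonneg hs (sub_nonneg.mpr (le_of_lt hst))

/-- Causal curves from `p` to `q` whose `τ`-variation tends to `τ q - τ p` produce a future causal
curve from `p` to `q`. -/
lemma exists_isFutureCausalCurve [T2Space M] {C r ε₀ : ℝ} (hτ : IsTemporal T τ) (hr : 0 < r)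
    (hR : IsAdapted T τ x C (chartBall N x r))
    (htgt : Metric.closedBall (extChartAt (𝓡 (N + 1)) x x) r ⊆ (extChartAt (𝓡 (N + 1)) x).target)
    (hp : p ∈ chartBall N x (r / 4)) (hq : q ∈ chartBall N x (r / 4)) (hle : τ p ≤ τ q)
    (hε₀ : 0 < ε₀) (hsmall : C * (τ q - τ p + ε₀) ≤ r / 2)
    (happrox : ∀ ε > 0, ∃ (γ : ℝ → M) (a b : ℝ), a ≤ b ∧ IsCausalCurve T γ a b ∧ γ a = p ∧
      γ b = q ∧ ∫ t in a..b, |deriv (τ ∘ γ) t| ≤ τ q - τ p + ε) :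
    ∃ γ : ℝ → M, IsFutureCausalCurve T γ (τ p) (τ q) ∧ γ (τ p) = p ∧ γ (τ q) = q := by
  set φ := extChartAt (𝓡 (N + 1)) x with hφ
  set ε : ℕ → ℝ := fun n ↦ ε₀ * (1 / ((n : ℝ) + 1)) with hεdef
  have hε (n : ℕ) : 0 < ε n := by positivity
  have hεle (n : ℕ) : ε n ≤ ε₀ := mul_le_of_le_one_right hε₀.le
    (div_le_one_of_le₀ (by linarith [n.cast_nonneg (α := ℝ)]) (by positivity))
  have hεlim : Tendsto ε (hyperfilter ℕ : Filter ℕ) (𝓝 0) := by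
    have := (tendsto_one_div_add_atTop_nhds_zero_nat (𝕜 := ℝ)).const_mul ε₀
    rw [mul_zero] at this
    exact this.mono_left Nat.hyperfilter_le_atTop
  have hz : ∀ n, ∃ z : ℝ → M, (∀ t ∈ Icc (τ p) (τ q), z t ∈ chartBall N x r ∧ τ (z t) = t) ∧
      z (τ p) = p ∧ ‖φ q - φ (z (τ q))‖ ≤ C * ε n ∧
      ∀ s ∈ Icc (τ p) (τ q), ∀ t ∈ Icc (τ p) (τ q), s ≤ t →
        ‖φ (z t) - φ (z s)‖ ≤ C * (t - s + ε n) ∧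
        ∀ (ℓ : EuclideanSpace ℝ (Fin (N + 1)) →L[ℝ] ℝ) (y : EuclideanSpace ℝ (Fin (N + 1))) (ρ : ℝ),
          (∀ z' ∈ chartBall N x r, φ z' ∈ Metric.ball y ρ →
            ∀ v : TangentSpace (𝓡 (N + 1)) z', IsFutureCausal T z' v → ℓ (coord x z' v) ≤ 0) →
          ‖φ (z s) - y‖ + C * (t - s + ε n) < ρ → ℓ (φ (z t) - φ (z s)) ≤ ‖ℓ‖ * C * ε n := by
    intro n
    obtain ⟨γ, a, b, hab, hγ, rfl, rfl, hlen⟩ := happrox (ε n) (hε n)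
    exact hγ.exists_sampling hτ hab hr hR htgt hp hle hlen
      ((mul_le_mul_of_nonneg_left (by linarith [hεle n]) hR.pos.le).trans hsmall)
  choose z hz1 hz2 hz3 hz4 using hz
  have hleft := left_mem_Icc.mpr hle
  have hright := right_mem_Icc.mpr hle
  -- the limit along an ultrafilter
  have hlim : ∀ t, ∃ y, t ∈ Icc (τ p) (τ q) → y ∈ Metric.closedBall (φ x) (3 * r / 4) ∧
      Tendsto (fun n ↦ φ (z n t)) (hyperfilter ℕ : Filter ℕ) (𝓝 y) := by
    intro t
    by_cases ht : t ∈ Icc (τ p) (τ q)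
    · have hmem (n : ℕ) : φ (z n t) ∈ Metric.closedBall (φ x) (3 * r / 4) := by
        have h1 := (hz4 n _ hleft t ht ht.1).1
        rw [hz2] at h1
        have h2 := hp.2
        rw [mem_preimage, Metric.mem_ball, dist_eq_norm] at h2
        have h3 := norm_add_le (φ (z n t) - φ p) (φ p - φ x)
        rw [sub_add_sub_cancel] at h3
        have h4 : C * (t - τ p + ε n) ≤ C * (τ q - τ p + ε₀) :=
          mul_le_mul_of_nonneg_left (by linarith [hεle n, ht.2]) hR.pos.le
        rw [Metric.mem_closedBall, dist_eq_norm]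
        linarith
      -- One fixed ultrafilter yields limits for all `t` simultaneously, with neither subsequences
      -- nor continuity of the samples.
      obtain ⟨y, hy, hy'⟩ := (isCompact_closedBall (φ x) (3 * r / 4)).ultrafilter_le_nhds
        ((hyperfilter ℕ).map fun n ↦ φ (z n t))
        (le_principal_iff.mpr (Eventually.of_forall hmem : ∀ᶠ n in (hyperfilter ℕ : Filter ℕ), _))
      exact ⟨y, fun _ ↦ ⟨hy, hy'⟩⟩
    · exact ⟨0, fun h ↦ absurd h ht⟩
  choose c hc using hlim
  have htarget : ∀ t ∈ Icc (τ p) (τ q), c t ∈ φ.target := fun t ht ↦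
    htgt (Metric.closedBall_subset_closedBall (by linarith) (hc t ht).1)
  have hleft_inv {w : M} {ρ : ℝ} (hw : w ∈ chartBall N x ρ) : φ.symm (φ w) = w :=
    φ.left_inv (by simpa [hφ] using hw.1)
  have hnorm : ∀ s ∈ Icc (τ p) (τ q), ∀ t ∈ Icc (τ p) (τ q), s ≤ t →
      ‖c t - c s‖ ≤ C * (t - s) := by
    intro s hs t ht hst
    have h1 : Tendsto (fun n ↦ C * (t - s + ε n)) (hyperfilter ℕ : Filter ℕ)
        (𝓝 (C * (t - s + 0))) := (hεlim.const_add _).const_mul _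
    rw [add_zero] at h1
    exact le_of_tendsto_of_tendsto' ((hc t ht).2.sub (hc s hs).2).norm h1
      fun n ↦ (hz4 n s hs t ht hst).1
  have hLip : LipschitzOnWith C.toNNReal c (Icc (τ p) (τ q)) := by
    refine LipschitzOnWith.of_dist_le_mul fun s hs t ht ↦ ?_
    rw [Real.coe_toNNReal _ hR.pos.le, dist_eq_norm, Real.dist_eq]
    rcases le_total s t with hst | hst
    · rw [norm_sub_rev, abs_sub_comm, abs_of_nonneg (sub_nonneg.mpr hst)]
      exact hnorm s hs t ht hst
    · rw [abs_of_nonneg (sub_nonneg.mpr hst)]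
      exact hnorm t ht s hs hst
  have hend1 : c (τ p) = φ p := by
    refine tendsto_nhds_unique (hc _ hleft).2 ?_
    simp only [hz2]
    exact tendsto_const_nhds
  have hend2 : c (τ q) = φ q := by
    have h1 : Tendsto (fun n ↦ C * ε n) (hyperfilter ℕ : Filter ℕ) (𝓝 0) := by
      simpa using hεlim.const_mul C
    have h2 := le_of_tendsto_of_tendsto' (tendsto_const_nhds.sub (hc _ hright).2).norm h1
      fun n ↦ hz3 n
    exact (sub_eq_zero.mp (norm_le_zero_iff.mp h2)).symm
  refine ⟨φ.symm ∘ c, isFutureCausalCurve_of_chart hτ hLip htarget (fun t ht ↦ ?_)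
    (fun t ht ℓ hℓ ↦ ?_), ?_, ?_⟩
  · have h1 : ContinuousAt φ.symm (c t) :=
      (continuousOn_extChartAt_symm x).continuousAt
        ((isOpen_extChartAt_target x).mem_nhds (htarget t ht))
    have h2 := (hτ.1.continuous.continuousAt.comp h1).tendsto.comp (hc t ht).2
    refine tendsto_nhds_unique h2 (tendsto_const_nhds.congr fun n ↦ ?_)
    simp only [Function.comp_apply]
    rw [hleft_inv (hz1 n t ht).1, (hz1 n t ht).2]
  · have htI := Ioo_subset_Icc_self ht
    have hsource : φ.symm (c t) ∈ (chartAt (EuclideanSpace ℝ (Fin (N + 1))) x).source := by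
      simpa [hφ] using φ.map_target (htarget t htI)
    have h1 : ContinuousAt φ.symm (c t) :=
      (continuousOn_extChartAt_symm x).continuousAt
        ((isOpen_extChartAt_target x).mem_nhds (htarget t htI))
    -- `ρ` is the coordinate radius around `c t` on which `ℓ` stays nonpositive on future cones;
    -- arcs from level `t` to a nearby level `s` stay inside for almost all `n`.
    obtain ⟨ρ, hρ, hball⟩ := Metric.mem_nhds_iff.mp
      (h1.eventually (eventually_nonpos_of_causal hτ hsource ℓ hℓ))
    have hcone : ∀ z' ∈ chartBall N x r, φ z' ∈ Metric.ball (c t) ρ →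
        ∀ v : TangentSpace (𝓡 (N + 1)) z', IsFutureCausal T z' v → ℓ (coord x z' v) ≤ 0 := by
      intro z' hz' hmem
      have := hball hmem
      rw [← hleft_inv hz']
      exact this
    have hnear : ∀ᶠ s in 𝓝[>] t, C * (s - t) < ρ := by
      have : Tendsto (fun s ↦ C * (s - t)) (𝓝[>] t) (𝓝 (C * (t - t))) :=
        tendsto_nhdsWithin_of_tendsto_nhds (by fun_prop : Continuous fun s ↦ C * (s - t)).continuousAt
      rw [sub_self, mul_zero] at this
      exact this.eventually (gt_mem_nhds hρ)
    filter_upwards [hnear, Ioc_mem_nhdsGT ht.2] with s hs hst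
    have hsI : s ∈ Icc (τ p) (τ q) := ⟨ht.1.le.trans hst.1.le, hst.2⟩
    have hlim1 : Tendsto (fun n ↦ ‖φ (z n t) - c t‖ + C * (s - t + ε n)) (hyperfilter ℕ : Filter ℕ)
        (𝓝 (‖c t - c t‖ + C * (s - t + 0))) :=
      ((hc t htI).2.sub tendsto_const_nhds).norm.add ((hεlim.const_add _).const_mul _)
    rw [sub_self, norm_zero, zero_add, add_zero] at hlim1
    have hlim2 : Tendsto (fun n ↦ ‖ℓ‖ * C * ε n) (hyperfilter ℕ : Filter ℕ) (𝓝 0) := by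
      simpa using hεlim.const_mul (‖ℓ‖ * C)
    refine le_of_tendsto_of_tendsto ((ℓ.continuous.tendsto _).comp
      ((hc s hsI).2.sub (hc t htI).2)) hlim2 ?_
    filter_upwards [hlim1.eventually (gt_mem_nhds hs)] with n hn
    exact (hz4 n t htI s hsI hst.1.le).2 ℓ (c t) ρ hcone hn
  · rw [Function.comp_apply, hend1, hleft_inv hp]
  · rw [Function.comp_apply, hend2, hleft_inv hq]

end Limit

/-! ### The null distance -/

section NullDist

lemma PiecewiseCausalPath.nullLength_nonneg (β : PiecewiseCausalPath T p q) :
    0 ≤ β.nullLength τ :=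
  Finset.sum_nonneg fun _ _ ↦ abs_nonneg _

lemma PiecewiseCausalPath.sub_le_nullLength (hτ : IsTemporal T τ) (β : PiecewiseCausalPath T p q) :
    τ q - τ p ≤ β.nullLength τ := by
  obtain ⟨h, hL⟩ := β.isCausalCurve_and_nullLength hτ
  have hle : β.s 0 ≤ β.s (Fin.last β.k) := β.strictMono.monotone (Fin.zero_le _)
  have := (hτ.absolutelyContinuousOnInterval_comp hle h.1).sub_le_integral_abs_deriv hle
  rwa [hL, Function.comp_apply, Function.comp_apply, β.source, β.target] at this

/-- A future causal curve, as a path with one piece. -/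
def IsFutureCausalCurve.toPath {γ : ℝ → M} (hab : a < b) (h : IsFutureCausalCurve T γ a b) :
    PiecewiseCausalPath T (γ a) (γ b) where
  k := 1
  s := ![a, b]
  strictMono := by
    rw [Fin.strictMono_iff_lt_succ]
    intro i
    fin_cases i
    simpa using hab
  toFun := γ
  causal i := by
    fin_cases i
    exact .inl (by simpa using h)
  source := by simp
  target := rfl

/-- The lower bound τ q - τ p on null lengths is attained by a one-piece future path, or by the path
with no pieces when p = q. -/
lemma causalRel_subset_nullDistRel (hτ : IsTemporal T τ) : causalRel T ⊆ nullDistRel T τ := by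
  rintro ⟨p, q⟩ hpq
  suffices h : ∃ β : PiecewiseCausalPath T p q, β.nullLength τ = τ q - τ p by
    obtain ⟨β, hβ⟩ := h
    refine le_antisymm (iInf_le_of_le β (by rw [hβ])) (le_iInf fun β' ↦ ?_)
    exact EReal.coe_le_coe_iff.mpr (β'.sub_le_nullLength hτ)
  rcases hpq with h | ⟨γ, a, b, hab, hγ, hp, hq⟩
  · obtain rfl : p = q := h
    refine ⟨⟨0, fun _ ↦ 0, fun i j hij ↦ absurd hij (by omega), fun _ ↦ p, fun i ↦ i.elim0, rfl, rfl⟩, ?_⟩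
    simp [PiecewiseCausalPath.nullLength]
  · obtain rfl : γ a = p := hp
    obtain rfl : γ b = q := hq
    refine ⟨hγ.toPath hab, ?_⟩
    rw [← ((hγ.toPath hab).isCausalCurve_and_nullLength hτ).2]
    exact hγ.integral_abs_deriv hτ hab.le

lemma exists_isCausalCurve_of_mem_nullDistRel (hτ : IsTemporal T τ)
    (h : (p, q) ∈ nullDistRel T τ) {ε : ℝ} (hε : 0 < ε) :
    ∃ (γ : ℝ → M) (a b : ℝ), a ≤ b ∧ IsCausalCurve T γ a b ∧ γ a = p ∧ γ b = q ∧
      ∫ t in a..b, |deriv (τ ∘ γ) t| ≤ τ q - τ p + ε := by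
  have hlt : nullDist T τ p q < ((τ q - τ p + ε : ℝ) : EReal) := by
    rw [show nullDist T τ p q = _ from h, EReal.coe_lt_coe_iff]
    linarith
  obtain ⟨β, hβ⟩ := iInf_lt_iff.mp hlt
  obtain ⟨h1, h2⟩ := β.isCausalCurve_and_nullLength hτ
  exact ⟨β.toFun, _, _, β.strictMono.monotone (Fin.zero_le _), h1, β.source, β.target,
    h2.trans_le (EReal.coe_lt_coe_iff.mp hβ).le⟩

lemma le_of_mem_nullDistRel (h : (p, q) ∈ nullDistRel T τ) : τ p ≤ τ q := by
  have h0 : (0 : EReal) ≤ nullDist T τ p q :=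
    le_iInf fun β ↦ EReal.coe_nonneg.mpr β.nullLength_nonneg
  rw [show nullDist T τ p q = _ from h, EReal.coe_nonneg] at h0
  exact sub_nonneg.mp h0

end NullDist

end

end Spacetime

theorem mainTheorem4 {N : ℕ} {M : Type*} [TopologicalSpace M] [T2Space M]
    [SecondCountableTopology M] [ChartedSpace (EuclideanSpace ℝ (Fin (N + 1))) M]
    [IsManifold (𝓡 (N + 1)) ∞ M] (g : Spacetime.LorentzMetric N M)
    (T : Spacetime.TimeOrientation g) (τ : M → ℝ) (hτ : Spacetime.IsTemporal T τ) (x : M) :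
    ∃ U ∈ 𝓝 x, Spacetime.causalRel T ∩ U ×ˢ U = Spacetime.nullDistRel T τ ∩ U ×ˢ U := by
  obtain ⟨C, r, hr, hR, htgt⟩ := Spacetime.exists_isAdapted_chartBall hτ x
  have hC := hR.pos
  -- On `U` one has τ q - τ p < 2δ; with ε₀ = δ the total is below 4δ = r/(2C), as confinement
  -- requires.
  set δ := r / (8 * C) with hδ
  have hδ0 : 0 < δ := by positivity
  have hCδ : C * (4 * δ) = r / 2 := by rw [hδ]; field_simp; norm_num
  refine ⟨Spacetime.chartBall N x (r / 4) ∩ τ ⁻¹' Metric.ball (τ x) δ,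
    Filter.inter_mem (Spacetime.chartBall_mem_nhds x (by positivity))
      (hτ.1.continuous.continuousAt (Metric.ball_mem_nhds _ hδ0)), ?_⟩
  refine Subset.antisymm
    (inter_subset_inter_left _ (Spacetime.causalRel_subset_nullDistRel hτ)) ?_
  rintro ⟨p, q⟩ ⟨hpq, hp, hq⟩
  refine ⟨?_, hp, hq⟩
  have hle := Spacetime.le_of_mem_nullDistRel hpq
  have hp2 := abs_lt.mp (Real.dist_eq _ _ ▸ Metric.mem_ball.mp hp.2)
  have hq2 := abs_lt.mp (Real.dist_eq _ _ ▸ Metric.mem_ball.mp hq.2)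
  obtain ⟨γ, hγ, hγp, hγq⟩ := Spacetime.exists_isFutureCausalCurve hτ hr hR htgt hp.1 hq.1 hle hδ0
    (by rw [← hCδ]; exact mul_le_mul_of_nonneg_left (by linarith [hp2.1, hq2.2]) hC.le)
    fun ε hε ↦ Spacetime.exists_isCausalCurve_of_mem_nullDistRel hτ hpq hε
  -- Equal τ-values collapse the parameter interval and force p = q, the reflexive case of J⁺.
  rcases hle.eq_or_lt with heq | hlt
  · exact .inl (by rw [← hγp, ← hγq, heq])
  · exact .inr ⟨γ, τ p, τ q, hlt, hγ, hγp, hγq⟩
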